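/- Let $C(2^{\mathbb N})$ be the Banach space of real-valued continuous functions on the Cantor set $2^{\mathbb N}$ with the supremum norm, and let $\mathbf{SB}$ be the set of all closed linear subspaces of $C(2^{\mathbb N})$, equipped with the Effros--Borel $\sigma$-algebra, i.e. the $\sigma$-algebra generated by the sets $\{X\in\mathbf{SB}: X\cap U\neq\varnothing\}$, $U\subset C(2^{\mathbb N})$ open. A set $\mathcal A\subset\mathbf{SB}$ is analytic if it is the image of a Borel subset of a standard Borel space under a Borel map. A set $\mathcal C\subset \mathbf{SB}$ is called Bossard generic if, whenever $\mathcal A\subset\mathbf{SB}$ is an analytic set which contains an isomorphic copy of each member of $\mathcal C$, there exists $Y\in\mathcal A$ which contains isomorphic copies of all members of $\mathbf{SB}$ (isomorphic means linearly homeomorphic). Theorem. Each of the following subsets of $\mathbf{SB}$ is Bossard generic: (i) $\mathbf{DP}$, the set of $X\in\mathbf{SB}$ with the Dunford--Pettis property: $\lim_n x_n^*(x_n)=0$ for all weakly null sequences $(x_n)$ in $X$ and $(x_n^*)$ in $X^*$; (ii) $\mathbf{V}$, the set of Schur spaces $X\in\mathbf{SB}$: every weakly null sequence in the unit ball of $X$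 is norm null; (iii) $\mathbf{BS}$, the set of $X\in\mathbf{SB}$ with the Banach--Saks property: every bounded sequence in $X$ has a subsequence whose arithmetic means converge in norm; (iv) $\mathbf{NC}_E$, the set of $X\in\mathbf{SB}$ which contain no subspace isomorphic to $E$, for every infinite-dimensional separable Banach space $E$ over $\mathbb R$; (v) $\mathbf{wBS}$, the set of $X\in\mathbf{SB}$ with the weak Banach--Saks property: every weakly null sequence in $X$ has a subsequence whose arithmetic means converge in norm. -/

import Mathlib

open Filter Topology

/-- The Banach space `C(2^ℕ)` of real continuous functions on the Cantor set, with the supremum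
norm. -/
abbrev CantorC : Type := C(ℕ → Bool, ℝ)

/-- The set `SB` of closed subsets of `C(2^ℕ)` which are linear subspaces. -/
abbrev SB : Type := ClosedSubmodule ℝ CantorC

namespace SB

/-- The separable Banach space coded by a point of `SB`, with the norm inherited from
`C(2^ℕ)`. -/
abbrev Carrier (X : SB) : Type := ↥(X.toSubmodule)

/-- The Effros-Borel structure on `SB`: the σ-algebra generated by the sets
`{X : X ∩ U ≠ ∅}`, with `U` ranging over the open subsets of `C(2^ℕ)`. -/
instance effrosBorel : MeasurableSpace SB :=
  MeasurableSpace.generateFrom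
    {S : Set SB | ∃ U : Set CantorC, IsOpen U ∧ S = {X : SB | ((X : Set CantorC) ∩ U).Nonempty}}

end SB

/-- A subset of a measurable space is analytic if it is the image of a Borel subset of a standard
Borel space under a Borel map. (Every standard Borel space is Borel isomorphic to one in `Type`, so
letting `S'` range over `Type` is no restriction.) -/
def IsAnalyticSubset {S : Type*} [MeasurableSpace S] (A : Set S) : Prop :=
  ∃ (S' : Type) (_ : MeasurableSpace S') (_ : StandardBorelSpace S') (B : Set S') (f : S' → S),
    MeasurableSet B ∧ Measurable f ∧ f '' B = A

section Operators

variable {X Y : Type*} [NormedAddCommGroup X] [NormedSpace ℝ X]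
  [NormedAddCommGroup Y] [NormedSpace ℝ Y]

/-- `x n` converges weakly to `0`. -/
def WeaklyNull (x : ℕ → X) : Prop :=
  ∀ φ : StrongDual ℝ X, Tendsto (fun n => φ (x n)) atTop (𝓝 0)

/-- The arithmetic means of the sequence converge in norm. -/
def CesaroSummable (x : ℕ → X) : Prop :=
  ∃ l : X, Tendsto (fun n : ℕ => (n : ℝ)⁻¹ • ∑ i ∈ Finset.range n, x i) atTop (𝓝 l)

/-- Completely continuous operators: weakly null sequences in the unit ball are mapped to norm null
sequences. -/
def IsCompletelyContinuousOp (A : X →L[ℝ] Y) : Prop :=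
  ∀ x : ℕ → X, (∀ n, ‖x n‖ ≤ 1) → WeaklyNull x → Tendsto (fun n => A (x n)) atTop (𝓝 0)

/-- The ideal of Dunford-Pettis operators: `y*ₙ (A xₙ) → 0` for all weakly null sequences `(y*ₙ)`
in `Y*` (with respect to `Y**`) and `(xₙ)` in `X`. -/
def IsDunfordPettisOp (A : X →L[ℝ] Y) : Prop :=
  ∀ (x : ℕ → X) (y' : ℕ → StrongDual ℝ Y), WeaklyNull x → WeaklyNull y' →
    Tendsto (fun n => y' n (A (x n))) atTop (𝓝 0)

/-- Banach-Saks operators: the image of every bounded sequence has a Cesàro summable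
subsequence. -/
def IsBanachSaksOp (A : X →L[ℝ] Y) : Prop :=
  ∀ x : ℕ → X, (∃ C : ℝ, ∀ n, ‖x n‖ ≤ C) →
    ∃ k : ℕ → ℕ, StrictMono k ∧ CesaroSummable (fun n => A (x (k n)))

/-- Weak Banach-Saks operators: the image of every weakly null sequence has a Cesàro summable
subsequence. -/
def IsWeakBanachSaksOp (A : X →L[ℝ] Y) : Prop :=
  ∀ x : ℕ → X, WeaklyNull x →
    ∃ k : ℕ → ℕ, StrictMono k ∧ CesaroSummable (fun n => A (x (k n)))

/-- `E`-singular operators: there is no subspace of `X` isomorphic to `E` on which `A` is an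
isomorphic embedding (that is, bounded below). For complete `E` such a subspace is automatically
closed. -/
def IsSingularOp (E : Type*) [NormedAddCommGroup E] [NormedSpace ℝ E] (A : X →L[ℝ] Y) : Prop :=
  ¬ ∃ Z : Submodule ℝ X, Nonempty (E ≃L[ℝ] Z) ∧ ∃ c : ℝ, 0 < c ∧ ∀ z ∈ Z, c * ‖z‖ ≤ ‖A z‖

end Operators

namespace SB

/-- Linear homeomorphism of the coded spaces. -/
def Isomorphic (X Y : SB) : Prop := Nonempty (X.Carrier ≃L[ℝ] Y.Carrier)

/-- `Y` contains an isomorphic copy of `X`: some subspace of `Y` (closed, since `X` is complete) is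
isomorphic to `X`. -/
def ContainsCopy (Y X : SB) : Prop :=
  ∃ Z : Submodule ℝ Y.Carrier, Nonempty (X.Carrier ≃L[ℝ] Z)

/-- Bossard generic subsets of `SB`: every analytic set that contains an isomorphic copy of each
member of `C` has a member which contains isomorphic copies of all members of `SB`. -/
def BossardGeneric (C : Set SB) : Prop :=
  ∀ A : Set SB, IsAnalyticSubset A → (∀ X ∈ C, ∃ X' ∈ A, Isomorphic X X') →
    ∃ Y ∈ A, ∀ Z : SB, ContainsCopy Y Z

/-- Spaces with the Dunford-Pettis property. -/
def DP : Set SB := {X | IsDunfordPettisOp (ContinuousLinearMap.id ℝ X.Carrier)}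

/-- Schur spaces. -/
def V : Set SB := {X | IsCompletelyContinuousOp (ContinuousLinearMap.id ℝ X.Carrier)}

/-- Spaces with the Banach-Saks property. -/
def BS : Set SB := {X | IsBanachSaksOp (ContinuousLinearMap.id ℝ X.Carrier)}

/-- Spaces not containing an isomorphic copy of `E`. -/
def NC (E : Type*) [NormedAddCommGroup E] [NormedSpace ℝ E] : Set SB :=
  {X | IsSingularOp E (ContinuousLinearMap.id ℝ X.Carrier)}

/-- Spaces with the weak Banach-Saks property. -/
def WBS : Set SB := {X | IsWeakBanachSaksOp (ContinuousLinearMap.id ℝ X.Carrier)}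

end SB

/-! Every member of `SB` is a subspace of C(2^ℕ), so it suffices to find in the analytic set a space
that contains C(2^ℕ) itself. Fix a monotone basis of C(2^ℕ) and an exponent q. To a tree T on ℕ is
attached a space with one unit vector per node: a node of length k carries the k-th basis vector,
and the norm is, recursively, the maximum of the supremum norms of the sums along paths and of the
ℓ_q sum of the norms over the immediate successors.

Along an infinite branch every ℓ_q sum has a single term, so the unit vectors are 2-equivalent to
the basis and span a copy of C(2^ℕ) (`exists_bddBelow_of_branch`). If T is well-founded, its space
embeds into the sum of a line and the ℓ_q sum of the spaces of its immediate subtrees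
(`exists_embedding_real_prod_lp`). By induction on T it has the Schur property for q = 1 and a
subsequence-uniform form of the Banach-Saks property for q = 2, because both pass to such sums
(`IsSchur.lp_one`, `IsUniformBanachSaks.lp_two`).

Now let an analytic set A contain copies of all spaces of well-founded trees. The trees whose unit
vectors are equivalent to a family in some member of A form an analytic set containing all
well-founded trees. By a diagonal argument such a set contains an ill-founded tree
(`exists_branch_of_analyticSet`), and the corresponding member of A contains C(2^ℕ).

The Schur property yields the Dunford-Pettis and weak Banach-Saks properties. For spaces without a
copy of E, either E is not Schur and q = 1 serves, or E is Schur and q = 2 serves, since a Schur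
space with the uniform Banach-Saks property is finite dimensional. -/

/-! ### Trees, and analytic sets containing all well-founded trees -/

/-- The initial segment of length `k` of an infinite sequence. -/
def branchPrefix : (ℕ → ℕ) → ℕ → List ℕ
  | _, 0 => []
  | β, k + 1 => β 0 :: branchPrefix (fun i => β (i + 1)) k

/-- The characteristic functions of prefix-closed sets of finite sequences. -/
def IsPrefixClosed (T : List ℕ → Bool) : Prop :=
  ∀ s t, T (s ++ t) = true → T s = true

/-- `β` is an infinite branch of `T`. -/
def IsBranch (T : List ℕ → Bool) (β : ℕ → ℕ) : Prop :=
  ∀ k, T (branchPrefix β k) = true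

/-- The section of `T` at the immediate successor `n` of the root. -/
def subtree (T : List ℕ → Bool) (n : ℕ) : List ℕ → Bool := fun s => T (n :: s)

@[simp] lemma length_branchPrefix (β : ℕ → ℕ) (k : ℕ) : (branchPrefix β k).length = k := by
  induction k generalizing β with
  | zero => rfl
  | succ k ih => simp [branchPrefix, ih]

lemma branchPrefix_injective (β : ℕ → ℕ) : Function.Injective (branchPrefix β) := fun a b h => by
  simpa using congrArg List.length h

lemma branchPrefix_append {β : ℕ → ℕ} {s t : List ℕ}
    (h : branchPrefix β (s ++ t).length = s ++ t) : branchPrefix β s.length = s := by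
  induction s generalizing β with
  | nil => rfl
  | cons a s ih =>
    simp only [List.cons_append, List.length_cons, branchPrefix, List.cons.injEq] at h ⊢
    exact ⟨h.1, ih h.2⟩

lemma branchPrefix_eq_iff {β γ : ℕ → ℕ} {k : ℕ} :
    branchPrefix β k = branchPrefix γ k ↔ ∀ i < k, β i = γ i := by
  induction k generalizing β γ with
  | zero => simp [branchPrefix]
  | succ k ih =>
    simp only [branchPrefix, List.cons.injEq, ih]
    constructor
    · rintro ⟨h0, h⟩ i hi
      cases i with
      | zero => exact h0
      | succ i => exact h i (by omega)
    · intro h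
      exact ⟨h 0 (by omega), fun i hi => h (i + 1) (by omega)⟩

/-- Induction over well-founded trees: a property passing from all immediate subtrees to the tree,
and holding for the empty tree, holds for every tree without infinite branches. -/
theorem wellFoundedTree_induction {P : (List ℕ → Bool) → Prop}
    (h0 : P fun _ => false) (hs : ∀ T, (∀ n, P (subtree T n)) → P T)
    {T : List ℕ → Bool} (hT : IsPrefixClosed T) (hb : ∀ β, ¬ IsBranch T β) : P T := by
  by_contra hP
  have step : ∀ S : {S // ¬ P S}, ∃ n, ¬ P (subtree S.1 n) := fun S => by
    by_contra! h
    exact S.2 (hs _ h)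
  choose c hc using step
  -- Descending forever through bad subtrees traces out an infinite branch.
  let seq : {S // ¬ P S} → ℕ → {S // ¬ P S} := fun S k =>
    Nat.rec S (fun _ R => ⟨subtree R.1 (c R), hc R⟩) k
  have seq_succ : ∀ k S, seq S (k + 1) = seq ⟨subtree S.1 (c S), hc S⟩ k := by
    intro k
    induction k with
    | zero => intro S; rfl
    | succ k ih =>
      intro S
      have h := ih S
      change (⟨subtree (seq S (k + 1)).1 (c (seq S (k + 1))), _⟩ : {S // ¬ P S}) =
        ⟨subtree (seq ⟨subtree S.1 (c S), hc S⟩ k).1 (c (seq ⟨subtree S.1 (c S), hc S⟩ k)), _⟩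
      simp only [h]
  -- A bad tree is not identically false, so some extension `t` of each node on the path belongs to
  -- it. Prefix-closedness, used only for the original tree, then removes `t`.
  have key : ∀ k (S : {S // ¬ P S}),
      ∃ t, S.1 (branchPrefix (fun i => c (seq S i)) k ++ t) = true := by
    intro k
    induction k with
    | zero =>
      intro S
      by_contra! h
      apply S.2
      have : S.1 = fun _ => false := by
        funext t
        simpa [branchPrefix] using h t
      rw [this]
      exact h0
    | succ k ih =>
      intro S
      obtain ⟨t, ht⟩ := ih ⟨subtree S.1 (c S), hc S⟩
      refine ⟨t, ?_⟩
      simp only [branchPrefix, seq_succ]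
      exact ht
  refine hb (fun i => c (seq ⟨T, hP⟩ i)) fun k => ?_
  obtain ⟨t, ht⟩ := key k ⟨T, hP⟩
  exact hT _ _ ht

open Classical in
/-- The tree of attempts to find `y` such that `g y` is the tree itself. -/
noncomputable def diagonalTree (g : (ℕ → ℕ) → List ℕ → Bool) (s : List ℕ) : Bool :=
  -- Only nodes with code below the length of `s` are compared; the code of a list is at least its
  -- length, so the recursion is on shorter nodes.
  decide (∃ y : ℕ → ℕ, branchPrefix y s.length = s ∧
    ∀ t : List ℕ, (h : Encodable.encode t < s.length) → g y t = diagonalTree g t)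
termination_by s.length
decreasing_by exact (Encodable.length_le_encode t).trans_lt h

lemma diagonalTree_eq_true {g : (ℕ → ℕ) → List ℕ → Bool} {s : List ℕ} :
    diagonalTree g s = true ↔ ∃ y : ℕ → ℕ, branchPrefix y s.length = s ∧
      ∀ t : List ℕ, Encodable.encode t < s.length → g y t = diagonalTree g t := by
  classical
  rw [diagonalTree]
  exact decide_eq_true_iff

/-- An analytic set of trees which contains all well-founded trees contains an ill-founded one. -/
theorem exists_branch_of_analyticSet {D : Set (List ℕ → Bool)} (hD : MeasureTheory.AnalyticSet D)
    (hwf : ∀ T, IsPrefixClosed T → (∀ β, ¬ IsBranch T β) → T ∈ D) :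
    ∃ T ∈ D, ∃ β, IsBranch T β := by
  rw [MeasureTheory.AnalyticSet] at hD
  rcases hD with rfl | ⟨g, hg, rfl⟩
  · refine absurd (hwf (fun _ => false) (fun _ _ h => h) fun β h => ?_) (by simp)
    simpa using h 0
  set T := diagonalTree g with hTdef
  have hpre : IsPrefixClosed T := fun s t h => by
    rw [hTdef, diagonalTree_eq_true] at h ⊢
    obtain ⟨y, hy, hy'⟩ := h
    refine ⟨y, branchPrefix_append hy, fun r hr => hy' r (hr.trans_le ?_)⟩
    simp
  have hbranch : ∃ β, IsBranch T β := by
    -- If the tree were well-founded, it would be `g y` for some `y`, and this `y` would be a branch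
    -- of it.
    by_contra! hno
    obtain ⟨y, hy⟩ := hwf T hpre hno
    refine hno y fun k => ?_
    rw [hTdef, diagonalTree_eq_true]
    exact ⟨y, by simp, fun t _ => by rw [hy]⟩
  obtain ⟨β, hβ⟩ := hbranch
  refine ⟨T, ⟨β, ?_⟩, β, hβ⟩
  -- The witnesses for the nodes of the branch converge to `β`, and `g` at these witnesses converges
  -- to the tree; continuity gives `g β = T`.
  have hβ' : ∀ k, ∃ y : ℕ → ℕ, branchPrefix y k = branchPrefix β k ∧
      ∀ t : List ℕ, Encodable.encode t < k → g y t = T t := fun k => by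
    have := hβ k
    rw [hTdef, diagonalTree_eq_true] at this
    simpa using this
  choose y hy hyT using hβ'
  have hlim : Tendsto y atTop (𝓝 β) := by
    rw [tendsto_pi_nhds]
    intro i
    refine tendsto_const_nhds.congr' ?_
    filter_upwards [eventually_gt_atTop i] with k hk
    exact ((branchPrefix_eq_iff.1 (hy k)) i hk).symm
  funext t
  have h1 : Tendsto (fun k => g (y k) t) atTop (𝓝 (g β t)) :=
    ((continuous_apply t).tendsto _).comp ((hg.tendsto β).comp hlim)
  have h2 : Tendsto (fun k => g (y k) t) atTop (𝓝 (T t)) := by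
    refine tendsto_const_nhds.congr' ?_
    filter_upwards [eventually_gt_atTop (Encodable.encode t)] with k hk
    exact (hyT k t hk).symm
  exact tendsto_nhds_unique h1 h2

/-! ### A monotone basis of C(2^ℕ) -/

/-- The binary digits of `n`, as a point of the Cantor set. -/
def binaryPoint (n : ℕ) : ℕ → Bool := fun i => n.testBit i

/-- The indicator function of the set of points of the Cantor set which begin with the binary
digits of `n`. These functions form a monotone Schauder basis of `C(2^ℕ)`. -/
noncomputable def cantorBasis (n : ℕ) : CantorC where
  toFun x := ∏ i ∈ Finset.range n.size, if x i = binaryPoint n i then 1 else 0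
  continuous_toFun := by
    refine continuous_finsetProd _ fun i _ => ?_
    exact (continuous_of_discreteTopology (f := fun b : Bool =>
      if b = binaryPoint n i then (1 : ℝ) else 0)).comp (continuous_apply i)

lemma cantorBasis_apply (n : ℕ) (x : ℕ → Bool) :
    cantorBasis n x = if ∀ i < n.size, x i = binaryPoint n i then 1 else 0 := by
  simp [cantorBasis, Finset.prod_ite_zero]

lemma cantorBasis_zero_apply (x : ℕ → Bool) : cantorBasis 0 x = 1 := by
  simp [cantorBasis_apply]

lemma norm_cantorBasis_le (n : ℕ) : ‖cantorBasis n‖ ≤ 1 := by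
  rw [ContinuousMap.norm_le _ zero_le_one]
  intro x
  rw [cantorBasis_apply]
  split_ifs <;> simp

lemma cantorBasis_binaryPoint_self (n : ℕ) : cantorBasis n (binaryPoint n) = 1 := by
  simp [cantorBasis_apply]

lemma norm_cantorBasis (n : ℕ) : ‖cantorBasis n‖ = 1 := by
  refine le_antisymm (norm_cantorBasis_le n) ?_
  simpa [cantorBasis_binaryPoint_self] using
    (cantorBasis n).norm_coe_le_norm (binaryPoint n)

lemma binaryPoint_eq_false {n i : ℕ} (h : n.size ≤ i) : binaryPoint n i = false :=
  Nat.testBit_eq_false_of_lt (Nat.size_le.1 h)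

/-- The digits of both numbers vanish from `k.size` on, so agreement below `k.size` would force `n =
k`. -/
lemma cantorBasis_binaryPoint_of_lt {n k : ℕ} (h : n < k) : cantorBasis k (binaryPoint n) = 0 := by
  rw [cantorBasis_apply, if_neg]
  intro hk
  refine h.ne (Nat.eq_of_testBit_eq fun i => ?_)
  rcases lt_or_ge i k.size with hi | hi
  · exact hk i hi
  · exact (binaryPoint_eq_false ((Nat.size_le_size h.le).trans hi)).trans
      (binaryPoint_eq_false hi).symm

/-- Truncating the expansion with respect to the basis amounts to evaluating at another point. -/
lemma exists_cantorBasis_truncation (x : ℕ → Bool) (N : ℕ) :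
    ∃ y, ∀ k, cantorBasis k y = if k < N + 1 then cantorBasis k x else 0 := by
  -- If `x` lies in the support of the last function kept, the binary point of its index works: it
  -- shares the first digits of `x`, and all later functions vanish there. If instead the last
  -- function vanishes at `x`, the point for the previous truncation serves again.
  have main : ∀ n, cantorBasis n x = 1 →
      ∀ k, cantorBasis k (binaryPoint n) = if k < n + 1 then cantorBasis k x else 0 := by
    intro n hn k
    have hn' : ∀ i < n.size, x i = binaryPoint n i := by
      by_contra h
      simp [cantorBasis_apply, h] at hn
    split_ifs with hk
    · simp only [cantorBasis_apply]
      refine if_congr (forall₂_congr fun i hi => ?_) rfl rfl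
      rw [hn' i (hi.trans_le (Nat.size_le_size (by omega)))]
    · exact cantorBasis_binaryPoint_of_lt (by omega)
  induction N with
  | zero => exact ⟨_, main 0 (cantorBasis_zero_apply x)⟩
  | succ N ih =>
    by_cases h : cantorBasis (N + 1) x = 1
    · exact ⟨_, main _ h⟩
    · have h0 : cantorBasis (N + 1) x = 0 := by
        rw [cantorBasis_apply] at h ⊢
        split_ifs at h ⊢ with h1
        · exact absurd rfl h
        · rfl
      obtain ⟨y, hy⟩ := ih
      refine ⟨y, fun k => ?_⟩
      rw [hy]
      rcases lt_trichotomy k (N + 1) with hk | rfl | hk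
      · simp [hk, hk.trans (Nat.lt_succ_self _)]
      · simp [h0]
      · rw [if_neg (by omega), if_neg (by omega)]

/-- The basis is monotone. -/
lemma norm_sum_cantorBasis_le (c : ℕ → ℝ) {N M : ℕ} (h : N ≤ M) :
    ‖∑ k ∈ Finset.range N, c k • cantorBasis k‖ ≤
      ‖∑ k ∈ Finset.range M, c k • cantorBasis k‖ := by
  rcases N with _ | N
  · simp
  rw [ContinuousMap.norm_le _ (norm_nonneg _)]
  intro x
  obtain ⟨y, hy⟩ := exists_cantorBasis_truncation x N
  refine le_trans (le_of_eq ?_) (ContinuousMap.norm_coe_le_norm _ y)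
  congr 1
  simp only [ContinuousMap.coe_sum, ContinuousMap.coe_smul, Finset.sum_apply, Pi.smul_apply, hy,
    smul_ite, smul_zero]
  rw [← Finset.sum_subset (Finset.range_mono h)]
  · exact Finset.sum_congr rfl fun k hk => by rw [if_pos (Finset.mem_range.1 hk)]
  · intro k _ hk
    rw [if_neg (by simpa using hk)]

/-- The supports are cylinders, and two cylinders are nested or disjoint. -/
lemma cantorBasis_mul_of_size_le {j k : ℕ} (h : j.size ≤ k.size) :
    cantorBasis j * cantorBasis k = cantorBasis k ∨ cantorBasis j * cantorBasis k = 0 := by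
  by_cases hjk : ∀ i < j.size, binaryPoint k i = binaryPoint j i
  · left
    ext x
    simp only [ContinuousMap.mul_apply, cantorBasis_apply, mul_ite, mul_one, mul_zero]
    refine if_ctx_congr Iff.rfl (fun hx => if_pos fun i hi => ?_) fun _ => rfl
    rw [hx i (hi.trans_le h), hjk i hi]
  · right
    ext x
    simp only [ContinuousMap.mul_apply, cantorBasis_apply, mul_ite, mul_one, mul_zero]
    split_ifs with h1 h2
    · exact absurd (fun i hi => by rw [← h1 i (hi.trans_le h), h2 i hi]) hjk
    · rfl
    · rfl

/-- The submonoid formed by the basis and `0`. -/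
def cantorBasisMonoid : Submonoid CantorC where
  carrier := insert 0 (Set.range cantorBasis)
  one_mem' := Or.inr ⟨0, by ext x; simp [cantorBasis_zero_apply]⟩
  mul_mem' := by
    rintro _ _ (rfl | ⟨j, rfl⟩) (rfl | ⟨k, rfl⟩)
    · simp
    · simp
    · simp
    · rcases le_total j.size k.size with h | h
      · rcases cantorBasis_mul_of_size_le h with h | h <;> simp [h]
      · rw [mul_comm]
        rcases cantorBasis_mul_of_size_le h with h | h <;> simp [h]

lemma exists_cantorBasis_ne {x y : ℕ → Bool} (h : x ≠ y) :
    ∃ n, cantorBasis n x ≠ cantorBasis n y := by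
  obtain ⟨i, hi⟩ := Function.ne_iff.1 h
  by_contra! hn
  have key : ∀ (z w : ℕ → Bool) (j : ℕ), z j = true → w j = false →
      ∃ n, cantorBasis n z ≠ cantorBasis n w := by
    intro z w j hz hw
    -- The digit of `z` at `j` is 1, so `n` has exactly `j + 1` digits and its cylinder does test
    -- position `j`. This is why the point with digit 1 has to come first.
    set n := Nat.ofBits (fun l : Fin (j + 1) => z l)
    have hbit : ∀ l, l < j + 1 → binaryPoint n l = z l := fun l hl => Nat.testBit_ofBits_lt _ _ hl
    have hlt : n.size ≤ j + 1 := Nat.size_le.2 (Nat.ofBits_lt_two_pow _)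
    have hgt : j < n.size := by
      by_contra! hle
      have := hbit j (by omega)
      rw [binaryPoint_eq_false hle, hz] at this
      exact Bool.false_ne_true this
    refine ⟨n, ?_⟩
    rw [cantorBasis_apply, cantorBasis_apply, if_pos fun i hi => (hbit i (hi.trans_le hlt)).symm,
      if_neg fun h => ?_]
    · exact one_ne_zero
    · have := h j hgt
      rw [hbit j (by omega), hz, hw] at this
      exact Bool.false_ne_true this
  cases hx : x i <;> cases hy : y i
  · exact hi (hx.trans hy.symm)
  · obtain ⟨n, hne⟩ := key y x i hy hx
    exact hne (hn n).symm
  · obtain ⟨n, hne⟩ := key x y i hx hy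
    exact hne (hn n)
  · exact hi (hx.trans hy.symm)

/-- The basis together with 0 is closed under products, so its span is a subalgebra and
Stone-Weierstrass applies. -/
lemma topologicalClosure_span_cantorBasis :
    (Submodule.span ℝ (Set.range cantorBasis)).topologicalClosure = ⊤ := by
  have h1 : (Algebra.adjoin ℝ (cantorBasisMonoid : Set CantorC)).toSubmodule =
      Submodule.span ℝ (Set.range cantorBasis) := by
    rw [Algebra.adjoin_eq_span, Submonoid.closure_eq]
    exact Submodule.span_insert_zero
  have h2 := ContinuousMap.subalgebra_topologicalClosure_eq_top_of_separatesPoints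
    (Algebra.adjoin ℝ (cantorBasisMonoid : Set CantorC)) fun x y hxy => by
      obtain ⟨n, hn⟩ := exists_cantorBasis_ne hxy
      exact ⟨_, ⟨cantorBasis n, Algebra.subset_adjoin (Or.inr ⟨n, rfl⟩), rfl⟩, hn⟩
  rw [← h1]
  refine SetLike.coe_injective ?_
  have := congrArg (fun S : Subalgebra ℝ CantorC => (S : Set CantorC)) h2
  simpa using this

/-! ### Realising seminorms inside C(2^ℕ) -/

/-- Every seminorm on a space of finitely supported sequences is realised by a sequence in
`C(2^ℕ)`. -/
theorem exists_cantorC_coding {ι : Type} [Countable ι] (N : Seminorm ℝ (ι →₀ ℝ)) :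
    ∃ e : ι → CantorC, ∀ z, ‖Finsupp.linearCombination ℝ e z‖ = N z := by
  -- `K` is the dual unit ball of `N` in coordinates. It is compact and metrizable, hence a
  -- continuous image of the Cantor set; `e i` is the `i`-th coordinate along this map, and
  -- Hahn-Banach supplies a functional in `K` attaining `N z`.
  set K : Set (ι → ℝ) := {g | ∀ z, |Finsupp.linearCombination ℝ g z| ≤ N z} with hK
  have hcont : ∀ z : ι →₀ ℝ, Continuous fun g : ι → ℝ => Finsupp.linearCombination ℝ g z :=
    fun z => by
      simp only [Finsupp.linearCombination_apply, Finsupp.sum]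
      fun_prop
  have hclosed : IsClosed K := by
    rw [hK, Set.ofPred_forall]
    exact isClosed_iInter fun z => isClosed_le (hcont z).abs continuous_const
  have hsub : K ⊆ Set.pi Set.univ fun i => Set.Icc (-N (Finsupp.single i 1))
      (N (Finsupp.single i 1)) := fun g hg i _ => by
    have := hg (Finsupp.single i 1)
    rw [Finsupp.linearCombination_single, one_smul] at this
    exact abs_le.1 this
  have hcomp : IsCompact K :=
    (isCompact_univ_pi fun i => isCompact_Icc).of_isClosed_subset hclosed hsub
  have : CompactSpace K := isCompact_iff_compactSpace.1 hcomp
  have : Nonempty K := ⟨0, fun z => by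
    have h : Finsupp.linearCombination ℝ (0 : ι → ℝ) z = 0 := by
      simp
    rw [h, abs_zero]
    exact apply_nonneg N z⟩
  let : MetricSpace K := TopologicalSpace.metrizableSpaceMetric K
  obtain ⟨φ, hφ, hφs⟩ := exists_nat_bool_continuous_surjective_of_compact K
  let e : ι → CantorC := fun i => ⟨fun x => (φ x : ι → ℝ) i,
    (continuous_apply i).comp (continuous_subtype_val.comp hφ)⟩
  have he : ∀ z x, Finsupp.linearCombination ℝ e z x =
      Finsupp.linearCombination ℝ (φ x : ι → ℝ) z := fun z x => by
    simp [Finsupp.linearCombination_apply, Finsupp.sum, e]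
  refine ⟨e, fun z => le_antisymm ?_ ?_⟩
  · rw [ContinuousMap.norm_le _ (apply_nonneg N z)]
    intro x
    rw [he, Real.norm_eq_abs]
    exact (φ x).2 z
  · rcases eq_or_ne z 0 with rfl | hz
    · simp
    obtain ⟨f, hf, hfN⟩ := exists_extension_of_le_sublinear
      (LinearPMap.mkSpanSingleton z (N z) hz) N
      (fun c hc x => by rw [map_smul_eq_mul, Real.norm_of_nonneg hc.le]) (map_add_le_add N) (by
        rintro ⟨x, hx⟩
        obtain ⟨c, rfl⟩ := Submodule.mem_span_singleton.1 hx
        rw [LinearPMap.mkSpanSingleton'_apply, map_smul_eq_mul, smul_eq_mul, Real.norm_eq_abs]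
        exact mul_le_mul_of_nonneg_right (le_abs_self c) (apply_nonneg N z))
    have hfz : f z = N z := by
      rw [hf ⟨z, Submodule.mem_span_singleton_self z⟩, LinearPMap.mkSpanSingleton_apply]
    have hflc : ∀ w, Finsupp.linearCombination ℝ (fun i => f (Finsupp.single i 1)) w = f w :=
      fun w => by
        rw [Finsupp.linearCombination_apply, Finsupp.sum]
        conv_rhs => rw [← Finsupp.sum_single w, Finsupp.sum, map_sum]
        refine Finset.sum_congr rfl fun i _ => ?_
        rw [← map_smul, Finsupp.smul_single_one]
    have hfK : (fun i => f (Finsupp.single i 1)) ∈ K := fun w => by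
      rw [hflc, abs_le']
      refine ⟨hfN w, ?_⟩
      rw [← map_neg, ← map_neg_eq_map N w]
      exact hfN (-w)
    obtain ⟨x, hx⟩ := hφs ⟨_, hfK⟩
    calc N z = Finsupp.linearCombination ℝ e z x := by rw [he, hx, hflc, hfz]
      _ ≤ |Finsupp.linearCombination ℝ e z x| := le_abs_self _
      _ ≤ _ := ContinuousMap.norm_coe_le_norm (Finsupp.linearCombination ℝ e z) x

/-! ### The tree norm -/

/-- The restriction of a finitely supported function on the tree of finite sequences to the subtree
above the immediate successor `n` of the root. -/
noncomputable def childMap (n : ℕ) : (List ℕ →₀ ℝ) →ₗ[ℝ] (List ℕ →₀ ℝ) :=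
  Finsupp.lcomapDomain (List.cons n) (List.cons_injective)

@[simp] lemma childMap_apply (n : ℕ) (z : List ℕ →₀ ℝ) (s : List ℕ) :
    childMap n z s = z (n :: s) := rfl

lemma childMap_single_nil (n : ℕ) (a : ℝ) : childMap n (Finsupp.single [] a) = 0 := by
  ext s; simp

lemma childMap_single_cons_self (n : ℕ) (s : List ℕ) (a : ℝ) :
    childMap n (Finsupp.single (n :: s) a) = Finsupp.single s a := by
  ext t; simp [Finsupp.single_apply]

lemma childMap_single_cons_of_ne {n k : ℕ} (h : k ≠ n) (s : List ℕ) (a : ℝ) :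
    childMap n (Finsupp.single (k :: s) a) = 0 := by
  ext t; simp [h]

lemma finite_childMap_ne_zero (z : List ℕ →₀ ℝ) : {n | childMap n z ≠ 0}.Finite := by
  refine (z.support.finite_toSet.image fun s => s.headD 0).subset fun n hn => ?_
  obtain ⟨s, hs⟩ := Finsupp.ne_iff.1 hn
  exact ⟨n :: s, by simpa using hs, rfl⟩

/-- The vector `∑_{s ≼ v} z(s) u_{m + |s|}`. -/
noncomputable def pathSum : List ℕ → ℕ → (List ℕ →₀ ℝ) →ₗ[ℝ] CantorC
  | [], m => (Finsupp.lapply []).smulRight (cantorBasis m)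
  | n :: v, m => (Finsupp.lapply []).smulRight (cantorBasis m) + pathSum v (m + 1) ∘ₗ childMap n

lemma pathSum_nil (m : ℕ) (z : List ℕ →₀ ℝ) : pathSum [] m z = z [] • cantorBasis m := rfl

lemma pathSum_cons (n : ℕ) (v : List ℕ) (m : ℕ) (z : List ℕ →₀ ℝ) :
    pathSum (n :: v) m z = z [] • cantorBasis m + pathSum v (m + 1) (childMap n z) := rfl

lemma norm_pathSum_single_le (v : List ℕ) (m : ℕ) (s : List ℕ) (a : ℝ) :
    ‖pathSum v m (Finsupp.single s a)‖ ≤ |a| := by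
  induction v generalizing m s with
  | nil =>
    rw [pathSum_nil, norm_smul, norm_cantorBasis, mul_one, Real.norm_eq_abs, Finsupp.single_apply]
    split_ifs <;> simp
  | cons n v ih =>
    rw [pathSum_cons]
    rcases s with _ | ⟨k, s⟩
    · simp [childMap_single_nil, norm_smul, norm_cantorBasis]
    · rcases eq_or_ne k n with rfl | h
      · simpa [childMap_single_cons_self, Finsupp.single_apply] using ih (m + 1) s
      · simp [childMap_single_cons_of_ne h]

/-- Boundedness is what makes the real supremum in `pathNorm` meaningful, as an unbounded supremum
defaults to 0. -/
lemma exists_norm_pathSum_le (z : List ℕ →₀ ℝ) : ∃ C, ∀ v m, ‖pathSum v m z‖ ≤ C := by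
  induction z using Finsupp.induction_linear with
  | zero => exact ⟨0, by simp⟩
  | add f g hf hg =>
    obtain ⟨C, hC⟩ := hf
    obtain ⟨D, hD⟩ := hg
    refine ⟨C + D, fun v m => ?_⟩
    rw [map_add]
    exact (norm_add_le _ _).trans (add_le_add (hC v m) (hD v m))
  | single s a => exact ⟨|a|, fun v m => norm_pathSum_single_le v m s a⟩

/-- The seminorm `sup_v ‖∑_{s ≼ v} z(s) u_{m + |s|}‖`. -/
noncomputable def pathNorm (m : ℕ) (z : List ℕ →₀ ℝ) : ℝ := ⨆ v, ‖pathSum v m z‖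

lemma norm_pathSum_le (v : List ℕ) (m : ℕ) (z : List ℕ →₀ ℝ) :
    ‖pathSum v m z‖ ≤ pathNorm m z := by
  obtain ⟨C, hC⟩ := exists_norm_pathSum_le z
  exact le_ciSup (f := fun v => ‖pathSum v m z‖) ⟨C, by rintro _ ⟨v, rfl⟩; exact hC v m⟩ v

lemma pathNorm_le {m : ℕ} {z : List ℕ →₀ ℝ} {C : ℝ} (h : ∀ v, ‖pathSum v m z‖ ≤ C) :
    pathNorm m z ≤ C := ciSup_le h

lemma pathNorm_nonneg (m : ℕ) (z : List ℕ →₀ ℝ) : 0 ≤ pathNorm m z :=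
  Real.iSup_nonneg fun _ => norm_nonneg _

lemma pathNorm_add_le (m : ℕ) (z w : List ℕ →₀ ℝ) :
    pathNorm m (z + w) ≤ pathNorm m z + pathNorm m w := pathNorm_le fun v => by
  rw [map_add]
  exact (norm_add_le _ _).trans (add_le_add (norm_pathSum_le v m z) (norm_pathSum_le v m w))

lemma pathNorm_smul (m : ℕ) (a : ℝ) (z : List ℕ →₀ ℝ) :
    pathNorm m (a • z) = |a| * pathNorm m z := by
  simp only [pathNorm, map_smul, norm_smul, Real.norm_eq_abs, Real.mul_iSup_of_nonneg (abs_nonneg a)]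

lemma pathNorm_zero (m : ℕ) : pathNorm m 0 = 0 := by simp [pathNorm]

lemma pathNorm_single_nil (m : ℕ) (a : ℝ) : pathNorm m (Finsupp.single [] a) = |a| := by
  have h : ∀ v, ‖pathSum v m (Finsupp.single [] a)‖ = |a| := fun v => by
    cases v <;> simp [pathSum_nil, pathSum_cons, childMap_single_nil, norm_smul, norm_cantorBasis]
  simp [pathNorm, h]

lemma abs_apply_nil_le_pathNorm (m : ℕ) (z : List ℕ →₀ ℝ) : |z []| ≤ pathNorm m z := by
  simpa [pathSum_nil, norm_smul, norm_cantorBasis] using norm_pathSum_le [] m z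

/-- The `ℓ_q` norm of a sequence of nonnegative reals. -/
noncomputable def ellNorm (q : ℝ) (a : ℕ → ℝ) : ℝ := (∑' n, a n ^ q) ^ (1 / q)

section ellNorm

variable {q : ℝ} {a b : ℕ → ℝ}

lemma summable_rpow_of_finite (hq : 1 ≤ q) (ha : {n | a n ≠ 0}.Finite) :
    Summable fun n => a n ^ q :=
  summable_of_hasFiniteSupport (ha.subset fun n hn h => hn (by
    simp [h, Real.zero_rpow (by linarith : q ≠ 0)]))

lemma ellNorm_nonneg (ha : ∀ n, 0 ≤ a n) : 0 ≤ ellNorm q a :=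
  Real.rpow_nonneg (tsum_nonneg fun n => Real.rpow_nonneg (ha n) _) _

lemma ellNorm_mono (hq : 1 ≤ q) (ha : ∀ n, 0 ≤ a n) (hab : ∀ n, a n ≤ b n)
    (hb : Summable fun n => b n ^ q) : ellNorm q a ≤ ellNorm q b := by
  have h : ∀ n, a n ^ q ≤ b n ^ q := fun n => Real.rpow_le_rpow (ha n) (hab n) (by linarith)
  have ha' : Summable fun n => a n ^ q :=
    Summable.of_nonneg_of_le (fun n => Real.rpow_nonneg (ha n) _) h hb
  exact Real.rpow_le_rpow (tsum_nonneg fun n => Real.rpow_nonneg (ha n) _)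
    (ha'.tsum_le_tsum h hb) (by positivity)

lemma ellNorm_mul_left (hq : 1 ≤ q) {c : ℝ} (hc : 0 ≤ c) (ha : ∀ n, 0 ≤ a n) :
    ellNorm q (fun n => c * a n) = c * ellNorm q a := by
  have hq0 : q ≠ 0 := by linarith
  simp only [ellNorm, Real.mul_rpow hc (ha _), tsum_mul_left]
  rw [Real.mul_rpow (Real.rpow_nonneg hc _) (tsum_nonneg fun n => Real.rpow_nonneg (ha n) _),
    one_div, Real.rpow_rpow_inv hc hq0]

lemma ellNorm_of_forall_ne (hq : 1 ≤ q) (ha : ∀ n, 0 ≤ a n) {k : ℕ} (h : ∀ n, n ≠ k → a n = 0) :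
    ellNorm q a = a k := by
  have hq0 : q ≠ 0 := by linarith
  rw [ellNorm, tsum_eq_single k fun n hn => by rw [h n hn, Real.zero_rpow hq0], one_div,
    Real.rpow_rpow_inv (ha k) hq0]

lemma le_ellNorm (hq : 1 ≤ q) (ha : ∀ n, 0 ≤ a n) (ha' : Summable fun n => a n ^ q) (k : ℕ) :
    a k ≤ ellNorm q a := by
  have hq0 : q ≠ 0 := by linarith
  rw [ellNorm, ← Real.rpow_rpow_inv (ha k) hq0, one_div]
  refine Real.rpow_le_rpow (Real.rpow_nonneg (ha k) _)
    (ha'.le_tsum k fun n _ => Real.rpow_nonneg (ha n) _) (by positivity)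

end ellNorm

/-- Approximations to the norm of the tree space: `d` is the number of levels of the tree at which
`ℓ_q` sums are taken, and the node `s` carries the basis vector with index `m + |s|`. -/
noncomputable def treeNormAux (q : ℝ) : ℕ → ℕ → (List ℕ →₀ ℝ) → ℝ
  | 0, m, z => pathNorm m z
  | d + 1, m, z => max (pathNorm m z) (ellNorm q fun n => treeNormAux q d (m + 1) (childMap n z))

section treeNormAux

variable {q : ℝ}

lemma treeNormAux_nonneg (d m : ℕ) (z : List ℕ →₀ ℝ) : 0 ≤ treeNormAux q d m z := by
  cases d with
  | zero => exact pathNorm_nonneg m z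
  | succ d => exact (pathNorm_nonneg m z).trans (le_max_left _ _)

lemma treeNormAux_zero (hq : 1 ≤ q) (d m : ℕ) : treeNormAux q d m 0 = 0 := by
  induction d generalizing m with
  | zero => exact pathNorm_zero m
  | succ d ih =>
    rw [treeNormAux, pathNorm_zero, ellNorm_of_forall_ne hq (fun n => treeNormAux_nonneg _ _ _)
      (k := 0) fun n _ => by rw [map_zero, ih]]
    rw [map_zero, ih, max_self]

lemma summable_treeNormAux (hq : 1 ≤ q) (d m : ℕ) (z : List ℕ →₀ ℝ) :
    Summable fun n => treeNormAux q d m (childMap n z) ^ q :=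
  summable_rpow_of_finite hq ((finite_childMap_ne_zero z).subset fun n hn h => hn (by
    simp only [h, treeNormAux_zero hq]))

lemma treeNormAux_add_le (hq : 1 ≤ q) (d m : ℕ) (z w : List ℕ →₀ ℝ) :
    treeNormAux q d m (z + w) ≤ treeNormAux q d m z + treeNormAux q d m w := by
  induction d generalizing m z w with
  | zero => exact pathNorm_add_le m z w
  | succ d ih =>
    refine max_le ((pathNorm_add_le m z w).trans
      (add_le_add (le_max_left _ _) (le_max_left _ _))) ?_
    refine le_trans ?_ (add_le_add (le_max_right _ _) (le_max_right _ _))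
    have h := Real.Lp_add_le_tsum_of_nonneg hq (fun n => treeNormAux_nonneg d (m + 1) (childMap n z))
      (fun n => treeNormAux_nonneg d (m + 1) (childMap n w)) (summable_treeNormAux hq _ _ z)
      (summable_treeNormAux hq _ _ w)
    refine le_trans (ellNorm_mono hq (fun n => treeNormAux_nonneg _ _ _) (fun n => ?_) h.1) h.2
    rw [map_add]
    exact ih _ _ _

lemma treeNormAux_smul (hq : 1 ≤ q) (d m : ℕ) (a : ℝ) (z : List ℕ →₀ ℝ) :
    treeNormAux q d m (a • z) = |a| * treeNormAux q d m z := by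
  induction d generalizing m z with
  | zero => exact pathNorm_smul m a z
  | succ d ih =>
    simp only [treeNormAux, pathNorm_smul, map_smul, ih]
    rw [ellNorm_mul_left hq (abs_nonneg a) fun n => treeNormAux_nonneg _ _ _,
      mul_max_of_nonneg _ _ (abs_nonneg a)]

/-- All nodes in the support of `z` have length less than `d`. -/
def DepthLE (d : ℕ) (z : List ℕ →₀ ℝ) : Prop := ∀ s, z s ≠ 0 → s.length < d

lemma DepthLE.mono {d e : ℕ} {z : List ℕ →₀ ℝ} (h : DepthLE d z) (hde : d ≤ e) : DepthLE e z :=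
  fun s hs => (h s hs).trans_le hde

lemma DepthLE.childMap {d : ℕ} {z : List ℕ →₀ ℝ} (h : DepthLE (d + 1) z) (n : ℕ) :
    DepthLE d (childMap n z) := fun s hs => by
  simpa using h (n :: s) hs

/-- Below the support only the zero vector is left, so the approximations stabilise. -/
lemma treeNormAux_eq_of_depthLE (hq : 1 ≤ q) {d e : ℕ} (hde : d ≤ e) (m : ℕ) {z : List ℕ →₀ ℝ}
    (h : DepthLE d z) : treeNormAux q e m z = treeNormAux q d m z := by
  induction d generalizing e m z with
  | zero =>
    have : z = 0 := by
      ext s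
      by_contra hs
      exact absurd (h s hs) (Nat.not_lt_zero _)
    rw [this, treeNormAux_zero hq, treeNormAux_zero hq]
  | succ d ih =>
    obtain ⟨e, rfl⟩ := Nat.exists_eq_add_of_le' (Nat.one_le_of_lt hde)
    simp only [treeNormAux]
    congr 2
    funext n
    exact ih (by omega) _ (h.childMap n)

/-- A bound for the lengths of the nodes in the support. -/
def supportDepth (z : List ℕ →₀ ℝ) : ℕ := z.support.sup List.length + 1

lemma depthLE_supportDepth (z : List ℕ →₀ ℝ) : DepthLE (supportDepth z) z := fun _ hs =>
  Nat.lt_succ_of_le (Finset.le_sup (f := List.length) (Finsupp.mem_support_iff.2 hs))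

/-- The norm of the `ℓ_q` tree space over the basis of `C(2^ℕ)`, with nodes of length `k` carrying
the basis vector with index `m + k`. -/
noncomputable def treeNorm (q : ℝ) (m : ℕ) (z : List ℕ →₀ ℝ) : ℝ :=
  treeNormAux q (supportDepth z) m z

lemma treeNorm_eq (hq : 1 ≤ q) {d : ℕ} (m : ℕ) {z : List ℕ →₀ ℝ} (h : DepthLE d z) :
    treeNorm q m z = treeNormAux q d m z := by
  rw [treeNorm, ← treeNormAux_eq_of_depthLE hq (le_max_left _ d) m (depthLE_supportDepth z),
    treeNormAux_eq_of_depthLE hq (le_max_right _ _) m h]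

/-- The tree norm as a seminorm. -/
noncomputable def treeSeminorm (q : ℝ) (hq : 1 ≤ q) (m : ℕ) : Seminorm ℝ (List ℕ →₀ ℝ) :=
  Seminorm.of (treeNorm q m)
    (fun z w => by
      set d := max (max (supportDepth z) (supportDepth w)) (supportDepth (z + w)) with hd
      rw [treeNorm_eq hq m ((depthLE_supportDepth z).mono (by omega : _ ≤ d)),
        treeNorm_eq hq m ((depthLE_supportDepth w).mono (by omega : _ ≤ d)),
        treeNorm_eq hq m ((depthLE_supportDepth (z + w)).mono (by omega : _ ≤ d))]
      exact treeNormAux_add_le hq _ _ _ _)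
    (fun a z => by
      rw [treeNorm_eq hq m (z := a • z) (d := supportDepth z) fun s hs =>
        depthLE_supportDepth z s fun h => hs (by simp [h])]
      exact treeNormAux_smul hq _ _ _ _)

lemma treeSeminorm_apply (hq : 1 ≤ q) (m : ℕ) (z : List ℕ →₀ ℝ) :
    treeSeminorm q hq m z = treeNorm q m z := rfl

lemma treeNorm_nonneg (m : ℕ) (z : List ℕ →₀ ℝ) : 0 ≤ treeNorm q m z := treeNormAux_nonneg _ _ _

/-- The norm at a node is determined by the norms at its immediate successors. -/
lemma treeNorm_eq_max (hq : 1 ≤ q) (m : ℕ) (z : List ℕ →₀ ℝ) :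
    treeNorm q m z = max (pathNorm m z) (ellNorm q fun n => treeNorm q (m + 1) (childMap n z)) := by
  have h := depthLE_supportDepth z
  rw [treeNorm, supportDepth, treeNormAux]
  congr 2
  funext n
  exact (treeNorm_eq hq _ (h.childMap n)).symm

lemma pathNorm_le_treeNorm (hq : 1 ≤ q) (m : ℕ) (z : List ℕ →₀ ℝ) :
    pathNorm m z ≤ treeNorm q m z := by
  rw [treeNorm_eq_max hq]
  exact le_max_left _ _

lemma ellNorm_childMap_le_treeNorm (hq : 1 ≤ q) (m : ℕ) (z : List ℕ →₀ ℝ) :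
    ellNorm q (fun n => treeNorm q (m + 1) (childMap n z)) ≤ treeNorm q m z := by
  rw [treeNorm_eq_max hq m z]
  exact le_max_right _ _

lemma summable_treeNorm (hq : 1 ≤ q) (m : ℕ) (z : List ℕ →₀ ℝ) :
    Summable fun n => treeNorm q m (childMap n z) ^ q :=
  summable_rpow_of_finite hq ((finite_childMap_ne_zero z).subset fun n hn h => hn (by
    rw [h, ← treeSeminorm_apply hq, map_zero]))

/-- With no mass at the root, a path sum lives in a single child, whose norm is one term of the ℓ_q
sum. -/
lemma treeNorm_of_apply_nil_eq_zero (hq : 1 ≤ q) (m : ℕ) {z : List ℕ →₀ ℝ} (hz : z [] = 0) :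
    treeNorm q m z = ellNorm q fun n => treeNorm q (m + 1) (childMap n z) := by
  rw [treeNorm_eq_max hq, max_eq_right]
  refine pathNorm_le fun v => ?_
  cases v with
  | nil =>
    rw [pathSum_nil, hz, zero_smul, norm_zero]
    exact ellNorm_nonneg fun n => treeNorm_nonneg _ _
  | cons n v =>
    rw [pathSum_cons, hz, zero_smul, zero_add]
    exact ((norm_pathSum_le _ _ _).trans (pathNorm_le_treeNorm hq _ _)).trans
      (le_ellNorm hq (fun n => treeNorm_nonneg _ _) (summable_treeNorm hq _ z) n)

lemma treeNorm_single_nil (hq : 1 ≤ q) (m : ℕ) (a : ℝ) :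
    treeNorm q m (Finsupp.single [] a) = |a| := by
  rw [treeNorm_eq_max hq, pathNorm_single_nil, max_eq_left]
  rw [ellNorm_of_forall_ne hq (fun n => treeNorm_nonneg _ _) (k := 0) fun n _ => by
    rw [childMap_single_nil, ← treeSeminorm_apply hq, map_zero]]
  rw [childMap_single_nil, ← treeSeminorm_apply hq, map_zero]
  exact abs_nonneg a

/-- Up to equivalence, the space above a node is the sum of a line and of the `ℓ_q` sum of the
spaces above its immediate successors. -/
lemma treeNorm_le_abs_add (hq : 1 ≤ q) (m : ℕ) (z : List ℕ →₀ ℝ) :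
    treeNorm q m z ≤ |z []| + ellNorm q fun n => treeNorm q (m + 1) (childMap n z) := by
  have h : treeNorm q m (z - Finsupp.single [] (z [])) =
      ellNorm q fun n => treeNorm q (m + 1) (childMap n z) := by
    rw [treeNorm_of_apply_nil_eq_zero hq m (by simp)]
    simp only [map_sub, childMap_single_nil, sub_zero]
  rw [← h, ← treeNorm_single_nil hq m, ← treeSeminorm_apply hq, ← treeSeminorm_apply hq,
    ← treeSeminorm_apply hq]
  calc treeSeminorm q hq m z = treeSeminorm q hq m
        (Finsupp.single [] (z []) + (z - Finsupp.single [] (z []))) := by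
          rw [add_sub_cancel]
    _ ≤ _ := map_add_le_add _ _ _

end treeNormAux

/-! ### The tree norm along a branch -/

section Branch

variable {q : ℝ}

/-- `z` vanishes outside the branch `β`. -/
def SupportedOnBranch (β : ℕ → ℕ) (z : List ℕ →₀ ℝ) : Prop :=
  ∀ s, z s ≠ 0 → s = branchPrefix β s.length

lemma SupportedOnBranch.childMap {β : ℕ → ℕ} {z : List ℕ →₀ ℝ} (h : SupportedOnBranch β z) :
    SupportedOnBranch (fun i => β (i + 1)) (childMap (β 0) z) := fun s hs => by
  have := h _ hs
  simpa [branchPrefix] using this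

lemma SupportedOnBranch.childMap_of_ne {β : ℕ → ℕ} {z : List ℕ →₀ ℝ} (h : SupportedOnBranch β z)
    {n : ℕ} (hn : n ≠ β 0) : _root_.childMap n z = 0 := by
  ext s
  by_contra hs
  have := h _ hs
  simp only [List.length_cons, branchPrefix, List.cons.injEq] at this
  exact hn this.1

lemma exists_pathSum_eq (v : List ℕ) (m : ℕ) {β : ℕ → ℕ} {z : List ℕ →₀ ℝ}
    (h : SupportedOnBranch β z) :
    ∃ b, pathSum v m z = ∑ k ∈ Finset.range b, z (branchPrefix β k) • cantorBasis (m + k) := by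
  induction v generalizing m β z with
  | nil => exact ⟨1, by simp [pathSum_nil, branchPrefix]⟩
  | cons n v ih =>
    rw [pathSum_cons]
    rcases eq_or_ne n (β 0) with rfl | hn
    · obtain ⟨b, hb⟩ := ih (m + 1) h.childMap
      refine ⟨b + 1, ?_⟩
      rw [hb, Finset.sum_range_succ', add_comm]
      congr 1
      exact Finset.sum_congr rfl fun k _ => by
        rw [add_right_comm, add_assoc]; rfl
    · exact ⟨1, by simp [h.childMap_of_ne hn, branchPrefix]⟩

/-- Only one child of each node is nonzero, so the norm unwinds to path norms of the tails along
`β`. Intervals rather than initial segments are needed because passing to a child drops the first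
term. -/
lemma treeNormAux_le_of_branch (hq : 1 ≤ q) (d m : ℕ) {β : ℕ → ℕ} {z : List ℕ →₀ ℝ}
    (h : SupportedOnBranch β z) {C : ℝ}
    (hC : ∀ a b, ‖∑ k ∈ Finset.Ico a b, z (branchPrefix β k) • cantorBasis (m + k)‖ ≤ C) :
    treeNormAux q d m z ≤ C := by
  have h0 : pathNorm m z ≤ C := pathNorm_le fun v => by
    obtain ⟨b, hb⟩ := exists_pathSum_eq v m h
    rw [hb, Finset.range_eq_Ico]
    exact hC 0 b
  induction d generalizing m β z with
  | zero => exact h0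
  | succ d ih =>
    refine max_le h0 ?_
    rw [ellNorm_of_forall_ne hq (fun n => treeNormAux_nonneg _ _ _) (k := β 0) fun n hn => by
      rw [h.childMap_of_ne hn, treeNormAux_zero hq]]
    have hC' : ∀ a b, ‖∑ k ∈ Finset.Ico a b, childMap (β 0) z
        (branchPrefix (fun i => β (i + 1)) k) • cantorBasis (m + 1 + k)‖ ≤ C := fun a b => by
      have := hC (a + 1) (b + 1)
      rw [← Finset.sum_Ico_add'] at this
      refine le_trans (le_of_eq ?_) this
      congr 1
      exact Finset.sum_congr rfl fun k _ => by
        rw [add_right_comm, add_assoc]; rfl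
    refine ih (m + 1) h.childMap hC' (pathNorm_le fun v => ?_)
    obtain ⟨b, hb⟩ := exists_pathSum_eq v (m + 1) h.childMap
    rw [hb, Finset.range_eq_Ico]
    exact hC' 0 b

/-- The vector with coefficients `c` along the branch `β`. -/
noncomputable def alongBranch (β : ℕ → ℕ) : (ℕ →₀ ℝ) →ₗ[ℝ] (List ℕ →₀ ℝ) :=
  Finsupp.lmapDomain ℝ ℝ (branchPrefix β)

lemma alongBranch_apply (β : ℕ → ℕ) (c : ℕ →₀ ℝ) (k : ℕ) :
    alongBranch β c (branchPrefix β k) = c k :=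
  Finsupp.mapDomain_apply (branchPrefix_injective β) _ _

lemma exists_of_alongBranch_ne_zero {β : ℕ → ℕ} {c : ℕ →₀ ℝ} {s : List ℕ}
    (h : alongBranch β c s ≠ 0) : ∃ k, s = branchPrefix β k := by
  by_contra! hs
  exact h (Finsupp.mapDomain_of_notMem_range _ _ (by rintro ⟨k, rfl⟩; exact hs k rfl))

lemma supportedOnBranch_alongBranch (β : ℕ → ℕ) (c : ℕ →₀ ℝ) :
    SupportedOnBranch β (alongBranch β c) := fun s hs => by
  obtain ⟨k, rfl⟩ := exists_of_alongBranch_ne_zero hs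
  simp

lemma pathSum_branchPrefix (β : ℕ → ℕ) (M m : ℕ) (z : List ℕ →₀ ℝ) :
    pathSum (branchPrefix β M) m z =
      ∑ k ∈ Finset.range (M + 1), z (branchPrefix β k) • cantorBasis (m + k) := by
  induction M generalizing β m z with
  | zero => simp [branchPrefix, pathSum_nil]
  | succ M ih =>
    rw [branchPrefix, pathSum_cons, ih, Finset.sum_range_succ' _ (M + 1), add_comm]
    congr 1
    exact Finset.sum_congr rfl fun k _ => by
      rw [add_right_comm, add_assoc]; rfl

lemma norm_sum_range_cantorBasis_le (c : ℕ →₀ ℝ) (N : ℕ) :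
    ‖∑ k ∈ Finset.range N, c k • cantorBasis k‖ ≤
      ‖Finsupp.linearCombination ℝ cantorBasis c‖ := by
  obtain ⟨M, hM⟩ := c.support.exists_nat_subset_range
  rw [Finsupp.linearCombination_apply, Finsupp.sum_of_support_subset c
    (hM.trans (Finset.range_mono (le_max_right N M))) _ (by simp)]
  exact norm_sum_cantorBasis_le c (le_max_left _ _)

lemma norm_le_treeNorm_alongBranch (hq : 1 ≤ q) (β : ℕ → ℕ) (c : ℕ →₀ ℝ) :
    ‖Finsupp.linearCombination ℝ cantorBasis c‖ ≤ treeNorm q 0 (alongBranch β c) := by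
  obtain ⟨M, hM⟩ := c.support.exists_nat_subset_range
  refine le_trans (le_of_eq ?_) ((norm_pathSum_le (branchPrefix β M) 0 _).trans
    (pathNorm_le_treeNorm hq 0 _))
  rw [pathSum_branchPrefix, Finsupp.linearCombination_apply, Finsupp.sum_of_support_subset c
    (hM.trans (Finset.range_mono (Nat.le_succ M))) _ (by simp)]
  simp only [alongBranch_apply, zero_add]

/-- The factor 2 arises from writing an interval sum as a difference of two initial sums, each
controlled by monotonicity of the basis. -/
lemma treeNorm_alongBranch_le (hq : 1 ≤ q) (β : ℕ → ℕ) (c : ℕ →₀ ℝ) :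
    treeNorm q 0 (alongBranch β c) ≤ 2 * ‖Finsupp.linearCombination ℝ cantorBasis c‖ := by
  refine treeNormAux_le_of_branch hq _ 0 (supportedOnBranch_alongBranch β c) fun a b => ?_
  simp only [alongBranch_apply, zero_add]
  rcases le_total a b with hab | hab
  · rw [Finset.sum_Ico_eq_sub _ hab, two_mul]
    exact (norm_sub_le _ _).trans (add_le_add (norm_sum_range_cantorBasis_le c b)
      (norm_sum_range_cantorBasis_le c a))
  · rw [Finset.Ico_eq_empty_of_le hab, Finset.sum_empty, norm_zero]
    positivity

end Branch

/-! ### The Schur property and ℓ₁ sums -/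

section Schur

variable {X Y : Type*} [NormedAddCommGroup X] [NormedSpace ℝ X]
  [NormedAddCommGroup Y] [NormedSpace ℝ Y]

lemma WeaklyNull.map {x : ℕ → X} (hx : WeaklyNull x) (J : X →L[ℝ] Y) :
    WeaklyNull fun n => J (x n) := fun φ => hx (φ.comp J)

variable (X) in
/-- Spaces in which weakly null sequences are norm null. -/
def IsSchur : Prop := ∀ x : ℕ → X, WeaklyNull x → Tendsto x atTop (𝓝 0)

lemma tendsto_zero_of_bddBelow {J : X →L[ℝ] Y} {c : ℝ} (hc : 0 < c) (hJ : ∀ x, c * ‖x‖ ≤ ‖J x‖)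
    {x : ℕ → X} (h : Tendsto (fun n => J (x n)) atTop (𝓝 0)) : Tendsto x atTop (𝓝 0) := by
  rw [tendsto_zero_iff_norm_tendsto_zero] at h ⊢
  have h' := h.const_mul c⁻¹
  rw [mul_zero] at h'
  refine squeeze_zero (fun _ => norm_nonneg _) (fun n => ?_) h'
  rw [← div_eq_inv_mul, le_div_iff₀' hc]
  exact hJ _

lemma IsSchur.of_bddBelow (hY : IsSchur Y) (J : X →L[ℝ] Y) {c : ℝ} (hc : 0 < c)
    (hJ : ∀ x, c * ‖x‖ ≤ ‖J x‖) : IsSchur X :=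
  fun _ hx => tendsto_zero_of_bddBelow hc hJ (hY _ (hx.map J))

lemma IsSchur.real_prod (hY : IsSchur Y) : IsSchur (ℝ × Y) := fun x hx => by
  have h1 := hx (ContinuousLinearMap.fst ℝ ℝ Y)
  have h2 := hY _ (hx.map (ContinuousLinearMap.snd ℝ ℝ Y))
  exact h1.prodMk_nhds h2

section

variable {E : ℕ → Type*} [∀ n, NormedAddCommGroup (E n)]

lemma hasSum_norm_lp_one (f : lp E 1) : HasSum (fun n => ‖f n‖) ‖f‖ := by
  simpa using lp.hasSum_norm (by simp) f

variable [∀ n, NormedSpace ℝ (E n)]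

/-- The functional on an `ℓ₁` sum with given bounded coordinates. -/
noncomputable def lpOneDual (f : ∀ n, StrongDual ℝ (E n)) (hf : ∀ n, ‖f n‖ ≤ 1) :
    StrongDual ℝ (lp E 1) :=
  have hle : ∀ (x : lp E 1) n, ‖f n (x n)‖ ≤ ‖x n‖ := fun x n =>
    ((f n).le_of_opNorm_le (hf n) _).trans_eq (one_mul _)
  have hs : ∀ x : lp E 1, Summable fun n => f n (x n) := fun x =>
    Summable.of_norm_bounded (hasSum_norm_lp_one x).summable (hle x)
  LinearMap.mkContinuous
    { toFun := fun x => ∑' n, f n (x n)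
      map_add' := fun x y => by
        rw [← (hs x).tsum_add (hs y)]
        simp
      map_smul' := fun a x => by
        rw [RingHom.id_apply, smul_eq_mul, ← tsum_mul_left]
        simp } 1 fun x => by
    rw [one_mul]
    exact tsum_of_norm_bounded (hasSum_norm_lp_one x) (hle x)

lemma hasSum_lpOneDual (f : ∀ n, StrongDual ℝ (E n)) (hf : ∀ n, ‖f n‖ ≤ 1) (x : lp E 1) :
    HasSum (fun n => f n (x n)) (lpOneDual f hf x) :=
  (Summable.of_norm_bounded (hasSum_norm_lp_one x).summable fun n =>
    ((f n).le_of_opNorm_le (hf n) _).trans_eq (one_mul _)).hasSum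

/-- If `f` norms `x` on the coordinates in `[M, M')`, and `x` is small elsewhere, then `f` almost
norms `x`. -/
lemma norm_sub_le_lpOneDual (f : ∀ n, StrongDual ℝ (E n)) (hf : ∀ n, ‖f n‖ ≤ 1) (x : lp E 1)
    {M M' : ℕ} (hMM : M ≤ M') {δ : ℝ} (h1 : ∑ n ∈ Finset.range M, ‖x n‖ ≤ δ)
    (h2 : ‖x‖ - δ ≤ ∑ n ∈ Finset.range M', ‖x n‖)
    (h3 : ∀ n, M ≤ n → n < M' → f n (x n) = ‖x n‖) :
    ‖x‖ - 4 * δ ≤ lpOneDual f hf x := by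
  -- The value is at least the middle mass minus head and tail, that is `‖x‖` minus twice head plus
  -- tail, and head and tail are each at most `δ`.
  have hle : ∀ n, -‖x n‖ ≤ f n (x n) := fun n => by
    have := ((f n).le_of_opNorm_le (hf n) (x n)).trans_eq (one_mul _)
    exact (abs_le.1 this).1
  have hx := hasSum_norm_lp_one x
  have hφ := hasSum_lpOneDual f hf x
  have hx' := (hasSum_nat_add_iff' M').2 hx
  have hφ' := (hasSum_nat_add_iff' M').2 hφ
  have h4 := hasSum_le (fun n => hle (n + M')) hx'.neg hφ'
  have h5 : ∑ n ∈ Finset.range M', f n (x n) = ∑ n ∈ Finset.range M, f n (x n) +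
      ∑ n ∈ Finset.Ico M M', f n (x n) := (Finset.sum_range_add_sum_Ico _ hMM).symm
  have h6 : ∑ n ∈ Finset.range M', ‖x n‖ = ∑ n ∈ Finset.range M, ‖x n‖ +
      ∑ n ∈ Finset.Ico M M', ‖x n‖ := (Finset.sum_range_add_sum_Ico _ hMM).symm
  have h7 : ∑ n ∈ Finset.Ico M M', f n (x n) = ∑ n ∈ Finset.Ico M M', ‖x n‖ :=
    Finset.sum_congr rfl fun n hn => by
      rw [Finset.mem_Ico] at hn
      exact h3 n hn.1 hn.2
  have h8 : -∑ n ∈ Finset.range M, ‖x n‖ ≤ ∑ n ∈ Finset.range M, f n (x n) := by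
    rw [← Finset.sum_neg_distrib]
    exact Finset.sum_le_sum fun n _ => hle n
  linarith

/-- The Schur property is stable under `ℓ₁` sums. -/
theorem IsSchur.lp_one (hE : ∀ n, IsSchur (E n)) : IsSchur (lp E 1) := by
  intro x hx
  by_contra hnot
  have hε : ∃ ε > 0, ∃ᶠ k in atTop, ε ≤ ‖x k‖ := by
    rw [tendsto_zero_iff_norm_tendsto_zero, Metric.tendsto_atTop] at hnot
    push Not at hnot
    obtain ⟨ε, hε, h⟩ := hnot
    refine ⟨ε, hε, frequently_atTop.2 fun N => ?_⟩
    obtain ⟨n, hn, h⟩ := h N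
    exact ⟨n, hn, by simpa using h⟩
  obtain ⟨ε, hε, hfreq⟩ := hε
  have hcoord : ∀ n, Tendsto (fun k => x k n) atTop (𝓝 0) := fun n =>
    hE n _ (hx.map (lp.evalCLM ℝ E 1 n))
  have hsum : ∀ N, Tendsto (fun k => ∑ n ∈ Finset.range N, ‖x k n‖) atTop (𝓝 0) := fun N => by
    simpa using tendsto_finsetSum (Finset.range N) fun n _ => (hcoord n).norm
  -- Gliding hump: a state is an index of the sequence and a cutoff. The next vector has mass at
  -- most `ε / 8` before the old cutoff and at most `ε / 8` beyond the new one.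
  have step : ∀ s : ℕ × ℕ, ∃ t : ℕ × ℕ, s.1 < t.1 ∧ s.2 < t.2 ∧ ε ≤ ‖x t.1‖ ∧
      ∑ n ∈ Finset.range s.2, ‖x t.1 n‖ ≤ ε / 8 ∧
      ‖x t.1‖ - ε / 8 ≤ ∑ n ∈ Finset.range t.2, ‖x t.1 n‖ := by
    rintro ⟨k, N⟩
    obtain ⟨k', hk', hk1, hk2⟩ := (hfreq.and_eventually (((hsum N).eventually
      (eventually_le_nhds (by positivity : 0 < ε / 8))).and (eventually_gt_atTop k))).exists
    obtain ⟨N', hN', hN1⟩ := (((hasSum_norm_lp_one (x k')).tendsto_sum_nat.eventually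
      (eventually_ge_nhds (by linarith : ‖x k'‖ - ε / 8 < ‖x k'‖))).and
      (eventually_gt_atTop N)).exists
    exact ⟨(k', N'), hk2, hN1, hk', hk1, hN'⟩
  choose nxt h1 h2 h3 h4 h5 using step
  let st : ℕ → ℕ × ℕ := fun i => nxt^[i] (0, 0)
  have hst : ∀ i, st (i + 1) = nxt (st i) := fun i => Function.iterate_succ_apply' _ _ _
  have hM : StrictMono fun i => (st i).2 := strictMono_nat_of_lt_succ fun i => by
    rw [hst]; exact h2 _
  have hK : StrictMono fun i => (st i).1 := strictMono_nat_of_lt_succ fun i => by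
    rw [hst]; exact h1 _
  have hex : ∀ n, ∃ i, n < (st (i + 1)).2 := fun n =>
    ⟨n, (Nat.lt_succ_self n).trans_le (hM.id_le (n + 1))⟩
  choose g hg1 hg2 using fun k n => exists_dual_vector'' ℝ (x k n)
  -- `Nat.find (hex n)` is the block containing the coordinate `n`; there `f` norms the hump of that
  -- block. One functional is thus at least `ε - 4 * (ε / 8)` on every hump.
  let f : ∀ n, StrongDual ℝ (E n) := fun n => g (st (Nat.find (hex n) + 1)).1 n
  have hfind : ∀ i n, (st i).2 ≤ n → n < (st (i + 1)).2 → Nat.find (hex n) = i := by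
    intro i n hi hi'
    rw [Nat.find_eq_iff]
    exact ⟨hi', fun j hj => not_lt.2 ((hM.monotone (Nat.succ_le_of_lt hj)).trans hi)⟩
  have hφ : ∀ i, ε / 2 ≤ lpOneDual f (fun n => hg1 _ _) (x (st (i + 1)).1) := by
    intro i
    refine le_trans ?_ (norm_sub_le_lpOneDual f (fun n => hg1 _ _) _ (M := (st i).2)
      (M' := (st (i + 1)).2) (hM.monotone (Nat.le_succ i)) (δ := ε / 8) ?_ ?_ ?_)
    · have := h3 (st i)
      rw [← hst] at this
      linarith
    · have := h4 (st i)
      rwa [← hst] at this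
    · have := h5 (st i)
      rwa [← hst] at this
    · intro n hn hn'
      have := hg2 (st (Nat.find (hex n) + 1)).1 n
      rw [hfind i n hn hn'] at this
      simp only [f]
      rw [hfind i n hn hn']
      exact this
  have hlim := ((hx (lpOneDual f fun n => hg1 _ _)).comp hK.tendsto_atTop).comp
    (tendsto_add_atTop_nat 1)
  have := ge_of_tendsto' hlim hφ
  linarith

end

/-- The vectors are norm null, and the functionals are bounded by Banach-Steinhaus. -/
lemma IsSchur.isDunfordPettisOp [CompleteSpace X] (hX : IsSchur X) :
    IsDunfordPettisOp (ContinuousLinearMap.id ℝ X) := by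
  intro x y' hx hy
  have hx0 := hX x hx
  have hbdd : ∃ C, ∀ n, ‖y' n‖ ≤ C := by
    refine banach_steinhaus fun z => ?_
    have h := hy (ContinuousLinearMap.apply ℝ ℝ z)
    obtain ⟨C, hC⟩ := (Metric.isBounded_range_of_tendsto _ h).exists_norm_le
    exact ⟨C, fun n => hC _ ⟨n, rfl⟩⟩
  obtain ⟨C, hC⟩ := hbdd
  rw [tendsto_zero_iff_norm_tendsto_zero] at hx0
  have := hx0.const_mul C
  rw [mul_zero] at this
  exact squeeze_zero_norm (fun n => (y' n).le_of_opNorm_le (hC n) (x n)) this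

lemma IsSchur.isCompletelyContinuousOp (hX : IsSchur X) :
    IsCompletelyContinuousOp (ContinuousLinearMap.id ℝ X) := fun x _ hx => hX x hx

lemma IsSchur.isWeakBanachSaksOp (hX : IsSchur X) :
    IsWeakBanachSaksOp (ContinuousLinearMap.id ℝ X) := fun x hx =>
  ⟨id, strictMono_id, 0, (hX x hx).cesaro_smul⟩

end Schur

/-! ### Diagonal sequences and the uniform Banach-Saks property -/

/-- Diagonal subsequences. -/
theorem exists_diagonal_subsequence (P : ℕ → (ℕ → ℕ) → Prop)
    (h : ∀ n k, StrictMono k → ∃ j : ℕ → ℕ, StrictMono j ∧ P n (k ∘ j))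
    (hsub : ∀ n k j, StrictMono j → P n k → P n (k ∘ j))
    (htail : ∀ n k s, P n (fun i => k (i + s)) → P n k) :
    ∃ k, StrictMono k ∧ ∀ n, P n k := by
  choose! j hj hP using h
  let κ : ℕ → ℕ → ℕ := fun n => Nat.rec id (fun m k => k ∘ j m k) n
  have hκ_succ : ∀ n, κ (n + 1) = κ n ∘ j n (κ n) := fun n => rfl
  have hκ : ∀ n, StrictMono (κ n) := fun n => by
    induction n with
    | zero => exact strictMono_id
    | succ n ih => exact ih.comp (hj n _ ih)
  have hd : ∀ i, κ i i < κ (i + 1) (i + 1) := fun i =>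
    hκ i ((Nat.lt_succ_self i).trans_le ((hj i _ (hκ i)).id_le (i + 1)))
  refine ⟨fun i => κ i i, strictMono_nat_of_lt_succ hd, fun n => ?_⟩
  -- `P n` holds from `κ (n + 1)` on, and past index `n + 1` the diagonal is a subsequence of `κ (n
  -- + 1)`.
  refine htail n _ (n + 1) ?_
  have hfac : ∀ i, ∃ e, StrictMono e ∧ κ (i + (n + 1)) = κ (n + 1) ∘ e := fun i => by
    induction i with
    | zero => exact ⟨id, strictMono_id, by simp⟩
    | succ i ih =>
      obtain ⟨e, he, hie⟩ := ih
      refine ⟨e ∘ j (i + (n + 1)) (κ (i + (n + 1))), he.comp (hj _ _ (hκ (i + (n + 1)))), ?_⟩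
      rw [← Function.comp_assoc, ← hie, add_right_comm]
  choose e he hκe using hfac
  have heq : (fun i => κ (i + (n + 1)) (i + (n + 1))) =
      κ (n + 1) ∘ fun i => e i (i + (n + 1)) := by
    funext i
    rw [hκe]
    rfl
  rw [heq]
  refine hsub n _ _ (strictMono_nat_of_lt_succ fun i => ?_) ?_
  · apply (hκ (n + 1)).lt_iff_lt.1
    have h1 : κ (n + 1) (e i (i + (n + 1))) = κ (i + (n + 1)) (i + (n + 1)) := by rw [hκe]; rfl
    have h2 : κ (n + 1) (e (i + 1) (i + 1 + (n + 1))) =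
        κ (i + 1 + (n + 1)) (i + 1 + (n + 1)) := by rw [hκe]; rfl
    rw [h1, h2, add_right_comm i 1]
    exact hd (i + (n + 1))
  · exact hP n _ (hκ n)

section UniformBanachSaks

/-- The averages of `y` over all large sets of large indices are small. -/
def UniformlyCesaroNull {X : Type*} [NormedAddCommGroup X] (y : ℕ → X) : Prop :=
  ∀ ε > 0, ∃ N : ℕ, ∀ F : Finset ℕ, (∀ i ∈ F, N ≤ i) → N ≤ F.card → ‖∑ i ∈ F, y i‖ ≤ ε * F.card

/-- The Banach-Saks property in a form that is uniform over subsequences. -/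
def IsUniformBanachSaks (X : Type*) [NormedAddCommGroup X] : Prop :=
  ∀ (x : ℕ → X) (C : ℝ), (∀ n, ‖x n‖ ≤ C) →
    ∃ k : ℕ → ℕ, StrictMono k ∧ ∃ l, UniformlyCesaroNull fun i => x (k i) - l

section

variable {X Y : Type*} [NormedAddCommGroup X] [NormedAddCommGroup Y]

lemma UniformlyCesaroNull.comp_strictMono {y : ℕ → X} (hy : UniformlyCesaroNull y) {k : ℕ → ℕ}
    (hk : StrictMono k) : UniformlyCesaroNull (y ∘ k) := fun ε hε => by
  obtain ⟨N, hN⟩ := hy ε hε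
  refine ⟨N, fun F hF hc => ?_⟩
  have := hN (F.map ⟨k, hk.injective⟩) (by
    simp only [Finset.mem_map, Function.Embedding.coeFn_mk, forall_exists_index, and_imp,
      forall_apply_eq_imp_iff₂]
    exact fun i hi => (hF i hi).trans (hk.id_le i)) (by simpa using hc)
  simpa using this

lemma UniformlyCesaroNull.of_tail {y : ℕ → X} {s : ℕ}
    (hy : UniformlyCesaroNull fun i => y (i + s)) : UniformlyCesaroNull y := fun ε hε => by
  obtain ⟨N, hN⟩ := hy ε hε
  refine ⟨N + s, fun F hF hc => ?_⟩
  have hinj : Set.InjOn (fun i => i - s) (F : Set ℕ) := fun a ha b hb hab => by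
    have := hF a ha
    have := hF b hb
    simp only at hab
    omega
  have hcard := Finset.card_image_of_injOn hinj
  have := hN (F.image fun i => i - s) (by
    simp only [Finset.mem_image, forall_exists_index, and_imp, forall_apply_eq_imp_iff₂]
    intro i hi
    have := hF i hi
    omega) (by omega)
  rw [hcard, Finset.sum_image hinj] at this
  convert this using 2
  refine Finset.sum_congr rfl fun i hi => ?_
  have := hF i hi
  rw [Nat.sub_add_cancel (by omega)]

lemma UniformlyCesaroNull.of_tendsto {y : ℕ → X} (hy : Tendsto y atTop (𝓝 0)) :
    UniformlyCesaroNull y := fun ε hε => by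
  obtain ⟨N, hN⟩ := Metric.tendsto_atTop.1 hy ε hε
  refine ⟨N, fun F hF _ => ?_⟩
  refine (norm_sum_le_of_le F fun i hi => ?_).trans_eq (by rw [Finset.sum_const, nsmul_eq_mul, mul_comm])
  simpa using (hN i (hF i hi)).le

lemma UniformlyCesaroNull.prodMk {y : ℕ → X} {z : ℕ → Y} (hy : UniformlyCesaroNull y)
    (hz : UniformlyCesaroNull z) : UniformlyCesaroNull fun i => (y i, z i) := fun ε hε => by
  obtain ⟨N, hN⟩ := hy ε hε
  obtain ⟨M, hM⟩ := hz ε hε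
  refine ⟨max N M, fun F hF hc => ?_⟩
  rw [Prod.norm_def, Prod.fst_sum, Prod.snd_sum]
  exact max_le (hN F (fun i hi => (le_max_left _ _).trans (hF i hi)) ((le_max_left _ _).trans hc))
    (hM F (fun i hi => (le_max_right _ _).trans (hF i hi)) ((le_max_right _ _).trans hc))

lemma IsUniformBanachSaks.prod (hX : IsUniformBanachSaks X) (hY : IsUniformBanachSaks Y) :
    IsUniformBanachSaks (X × Y) := fun x C hC => by
  obtain ⟨k, hk, l, hl⟩ := hX (fun i => (x i).1) C fun n => (norm_fst_le _).trans (hC n)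
  obtain ⟨j, hj, m, hm⟩ := hY (fun i => (x (k i)).2) C fun n => (norm_snd_le _).trans (hC _)
  exact ⟨k ∘ j, hk.comp hj, (l, m), (hl.comp_strictMono hj).prodMk hm⟩

lemma isUniformBanachSaks_real : IsUniformBanachSaks ℝ := fun x C hC => by
  obtain ⟨l, -, k, hk, hl⟩ := tendsto_subseq_of_bounded (Metric.isBounded_closedBall (x := (0 : ℝ))
    (r := C)) (x := x) fun n => by simpa using hC n
  exact ⟨k, hk, l, UniformlyCesaroNull.of_tendsto (tendsto_sub_nhds_zero_iff.2 hl)⟩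

end

variable {X Y : Type*} [NormedAddCommGroup X] [NormedSpace ℝ X]
  [NormedAddCommGroup Y] [NormedSpace ℝ Y]

lemma UniformlyCesaroNull.map {y : ℕ → X} (hy : UniformlyCesaroNull y) (J : X →L[ℝ] Y) :
    UniformlyCesaroNull fun i => J (y i) := fun ε hε => by
  obtain ⟨N, hN⟩ := hy (ε / (‖J‖ + 1)) (by positivity)
  refine ⟨N, fun F hF hc => ?_⟩
  rw [← map_sum]
  calc ‖J (∑ i ∈ F, y i)‖ ≤ ‖J‖ * (ε / (‖J‖ + 1) * F.card) := J.le_opNorm_of_le (hN F hF hc)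
    _ ≤ (‖J‖ + 1) * (ε / (‖J‖ + 1) * F.card) := by gcongr; linarith
    _ = ε * F.card := by field_simp

lemma UniformlyCesaroNull.tendsto_mean {y : ℕ → X} {l : X}
    (hy : UniformlyCesaroNull fun i => y i - l) :
    Tendsto (fun n : ℕ => (n : ℝ)⁻¹ • ∑ i ∈ Finset.range n, y i) atTop (𝓝 l) := by
  rw [Metric.tendsto_atTop]
  intro ε hε
  obtain ⟨N, hN⟩ := hy (ε / 4) (by positivity)
  set D := ‖∑ i ∈ Finset.range N, (y i - l)‖ with hD
  obtain ⟨M, hM⟩ := exists_nat_gt (D / (ε / 4))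
  -- `2 * N ≤ n` leaves at least `N` terms after the first `N`, and `M ≤ n` absorbs the fixed
  -- initial sum.
  refine ⟨max (2 * N) M + 1, fun n hn => ?_⟩
  have hn1 : 2 * N ≤ n := by omega
  have hn2 : M ≤ n := by omega
  have hn0 : (0 : ℝ) < n := by exact_mod_cast (by omega : 0 < n)
  have hDn : D ≤ ε / 4 * n := by
    rw [div_lt_iff₀ (by positivity)] at hM
    have : (M : ℝ) ≤ n := by exact_mod_cast hn2
    nlinarith
  have h1 := hN (Finset.Ico N n) (fun i hi => (Finset.mem_Ico.1 hi).1) (by simp; omega)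
  have h2 : ∑ i ∈ Finset.range n, (y i - l) =
      ∑ i ∈ Finset.range N, (y i - l) + ∑ i ∈ Finset.Ico N n, (y i - l) :=
    (Finset.sum_range_add_sum_Ico _ (by omega)).symm
  have h3 : ‖∑ i ∈ Finset.range n, (y i - l)‖ ≤ ε / 2 * n := by
    rw [h2]
    refine (norm_add_le _ _).trans ?_
    have h4 : ((Finset.Ico N n).card : ℝ) ≤ n := by
      rw [Nat.card_Ico]
      exact_mod_cast Nat.sub_le n N
    have : ε / 4 * (Finset.Ico N n).card ≤ ε / 4 * n := by gcongr
    linarith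
  have h5 : (n : ℝ)⁻¹ • ∑ i ∈ Finset.range n, y i - l =
      (n : ℝ)⁻¹ • ∑ i ∈ Finset.range n, (y i - l) := by
    rw [Finset.sum_sub_distrib, smul_sub, Finset.sum_const, Finset.card_range,
      ← Nat.cast_smul_eq_nsmul ℝ, smul_smul, inv_mul_cancel₀ hn0.ne', one_smul]
  rw [dist_eq_norm, h5, norm_smul, norm_inv, Real.norm_natCast, inv_mul_lt_iff₀ hn0]
  nlinarith

lemma IsUniformBanachSaks.isBanachSaksOp (hX : IsUniformBanachSaks X) :
    IsBanachSaksOp (ContinuousLinearMap.id ℝ X) := fun x ⟨C, hC⟩ => by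
  obtain ⟨k, hk, l, hl⟩ := hX x C hC
  exact ⟨k, hk, l, hl.tendsto_mean⟩

lemma IsUniformBanachSaks.of_bddBelow [CompleteSpace X] (hY : IsUniformBanachSaks Y)
    (J : X →L[ℝ] Y) {c : ℝ} (hc : 0 < c) (hJ : ∀ x, c * ‖x‖ ≤ ‖J x‖) :
    IsUniformBanachSaks X := fun x C hC => by
  obtain ⟨k, hk, l, hl⟩ := hY (fun i => J (x i)) (‖J‖ * C) fun n => J.le_opNorm_of_le (hC n)
  have hanti : AntilipschitzWith (Real.toNNReal c⁻¹) J := J.antilipschitz_of_bound fun z => by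
    rw [Real.coe_toNNReal _ (by positivity), ← div_eq_inv_mul, le_div_iff₀' hc]
    exact hJ z
  have hclosed : IsClosed (Set.range J) := hanti.isClosed_range J.uniformContinuous
  -- The range is closed and contains the means, hence their limit.
  obtain ⟨l', rfl⟩ : l ∈ Set.range J := hclosed.mem_of_tendsto hl.tendsto_mean
    (Eventually.of_forall fun n => ⟨(n : ℝ)⁻¹ • ∑ i ∈ Finset.range n, x (k i), by simp⟩)
  refine ⟨k, hk, l', fun ε hε => ?_⟩
  obtain ⟨N, hN⟩ := hl (c * ε) (by positivity)
  refine ⟨N, fun F hF hc' => ?_⟩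
  have h1 := hN F hF hc'
  simp only [← map_sub, ← map_sum] at h1
  have h2 := (hJ _).trans h1
  rw [mul_assoc] at h2
  exact le_of_mul_le_mul_left h2 hc

/-- If `φ (y n) ≥ ε` infinitely often, averages over arbitrarily large sets of such indices stay at
least `ε`. -/
lemma UniformlyCesaroNull.weaklyNull {y : ℕ → X} (hy : UniformlyCesaroNull y) : WeaklyNull y := by
  have key : ∀ (φ : StrongDual ℝ X), ∀ ε > 0, ∀ᶠ n in atTop, φ (y n) < ε := by
    intro φ ε hε
    by_contra h
    rw [not_eventually] at h
    obtain ⟨N, hN⟩ := hy.map φ (ε / 2) (by positivity)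
    have hinf : {n | N ≤ n ∧ ε ≤ φ (y n)}.Infinite := by
      rw [← Nat.frequently_atTop_iff_infinite]
      exact ((eventually_ge_atTop N).and_frequently h).mono fun n hn => ⟨hn.1, not_lt.1 hn.2⟩
    obtain ⟨F, hF, hFc⟩ := hinf.exists_subset_card_eq (N + 1)
    have h1 := hN F (fun i hi => (hF hi).1) (by omega)
    have h2 : F.card • ε ≤ ∑ i ∈ F, φ (y i) := Finset.card_nsmul_le_sum _ _ _ fun i hi => (hF hi).2
    have h3 := (le_abs_self _).trans h1
    rw [nsmul_eq_mul] at h2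
    have h4 : (0 : ℝ) < F.card := by exact_mod_cast (by omega : 0 < F.card)
    nlinarith
  intro φ
  rw [Metric.tendsto_nhds]
  intro ε hε
  filter_upwards [key φ ε hε, key (-φ) ε hε] with n h1 h2
  rw [Real.dist_eq, sub_zero, abs_lt]
  simp only [neg_apply] at h2
  exact ⟨by linarith, h1⟩

/-- A Schur space with the uniform Banach-Saks property is finite dimensional. -/
theorem IsSchur.finiteDimensional (h1 : IsSchur X) (h2 : IsUniformBanachSaks X) :
    FiniteDimensional ℝ X := by
  refine FiniteDimensional.of_isCompact_closedBall ℝ one_pos (c := 0)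
    (IsSeqCompact.isCompact fun x hx => ?_)
  obtain ⟨k, hk, l, hl⟩ := h2 x 1 fun n => by simpa using hx n
  have hlim : Tendsto (x ∘ k) atTop (𝓝 l) := tendsto_sub_nhds_zero_iff.1 (h1 _ hl.weaklyNull)
  exact ⟨l, Metric.isClosed_closedBall.mem_of_tendsto hlim (Eventually.of_forall fun n => hx _),
    k, hk, hlim⟩

/-- Bounded weakly null sequences in Hilbert spaces have uniformly Cesàro null subsequences. -/
theorem exists_uniformlyCesaroNull_of_inner {H : Type*} [NormedAddCommGroup H]
    [InnerProductSpace ℝ H] {w : ℕ → H} {C : ℝ} (hC : ∀ n, ‖w n‖ ≤ C)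
    (hw : ∀ v, Tendsto (fun n => inner ℝ (w n) v) atTop (𝓝 0)) :
    ∃ k : ℕ → ℕ, StrictMono k ∧ UniformlyCesaroNull (w ∘ k) := by
  -- The vectors are chosen almost orthogonal to all earlier ones: the `j`-th has inner products at
  -- most `1 / (j + 1)` with its at most `j` predecessors. Adding it to a sum raises the squared
  -- norm by at most `C ^ 2 + 2`.
  have step : ∀ n m : ℕ, ∃ i, m < i ∧ ∀ r ≤ m, |inner ℝ (w i) (w r)| ≤ 1 / ((n : ℝ) + 2) := by
    intro n m
    have h : ∀ r ∈ Finset.range (m + 1), ∀ᶠ i in atTop,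
        |inner ℝ (w i) (w r)| ≤ 1 / ((n : ℝ) + 2) := fun r _ => by
      have := (hw (w r)).abs
      rw [abs_zero] at this
      exact this.eventually (eventually_le_nhds (by positivity))
    obtain ⟨i, hi, hi'⟩ := (((Finset.range (m + 1)).eventually_all.2 h).and
      (eventually_gt_atTop m)).exists
    exact ⟨i, hi', fun r hr => hi r (Finset.mem_range.2 (by omega))⟩
  choose nxt hn1 hn2 using step
  let k : ℕ → ℕ := fun n => Nat.rec 0 (fun n m => nxt n m) n
  have hk_succ : ∀ n, k (n + 1) = nxt n (k n) := fun n => rfl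
  have hk : StrictMono k := strictMono_nat_of_lt_succ fun n => hn1 n (k n)
  have hin : ∀ i j, i < j → |inner ℝ (w (k j)) (w (k i))| ≤ 1 / ((j : ℝ) + 1) := by
    intro i j hij
    obtain ⟨j, rfl⟩ := Nat.exists_eq_add_of_lt hij
    have := hn2 (i + j) (k (i + j)) (k i) (hk.monotone (by omega))
    rw [← hk_succ] at this
    refine this.trans_eq ?_
    push_cast
    ring
  have hsq : ∀ F : Finset ℕ, ‖∑ i ∈ F, w (k i)‖ ^ 2 ≤ (C ^ 2 + 2) * F.card := by
    intro F
    induction F using Finset.induction_on_max with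
    | empty => simp
    | insert j F hF ih =>
      have hj : j ∉ F := fun h => (hF j h).false
      rw [Finset.sum_insert hj, Finset.card_insert_of_notMem hj, norm_add_sq_real]
      have h1 : ‖w (k j)‖ ^ 2 ≤ C ^ 2 := by gcongr; exact hC _
      have h2 : inner ℝ (w (k j)) (∑ i ∈ F, w (k i)) ≤ 1 := by
        rw [inner_sum]
        have h3 : ∀ i ∈ F, inner ℝ (w (k j)) (w (k i)) ≤ 1 / ((j : ℝ) + 1) := fun i hi =>
          (le_abs_self _).trans (hin i j (hF i hi))
        refine (Finset.sum_le_card_nsmul F _ _ h3).trans ?_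
        have h4 : F.card ≤ j := by
          simpa using Finset.card_le_card (fun i hi => Finset.mem_range.2 (hF i hi) :
            F ⊆ Finset.range j)
        have h5 : (F.card : ℝ) ≤ j := by exact_mod_cast h4
        rw [nsmul_eq_mul, mul_one_div, div_le_one (by positivity)]
        linarith
      push_cast
      linarith
  refine ⟨k, hk, fun ε hε => ?_⟩
  obtain ⟨N, hN⟩ := exists_nat_gt ((C ^ 2 + 2) / ε ^ 2)
  refine ⟨N, fun F _ hc => ?_⟩
  rw [div_lt_iff₀ (by positivity)] at hN
  refine (pow_le_pow_iff_left₀ (norm_nonneg _) (by positivity) two_ne_zero).1 ?_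
  refine (hsq F).trans ?_
  have h1 : (N : ℝ) ≤ F.card := by exact_mod_cast hc
  have h2 : C ^ 2 + 2 ≤ F.card * ε ^ 2 := hN.le.trans (by gcongr)
  calc (C ^ 2 + 2) * F.card ≤ F.card * ε ^ 2 * F.card := by gcongr
    _ = (ε * F.card) ^ 2 := by ring

end UniformBanachSaks

/-! ### The uniform Banach-Saks property and ℓ₂ sums -/

section

variable {E : ℕ → Type*} [∀ n, NormedAddCommGroup (E n)]

lemma lp_sum_apply {ι : Type*} (F : Finset ι) (f : ι → lp E 2) (n : ℕ) :
    (∑ i ∈ F, f i) n = ∑ i ∈ F, f i n := by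
  rw [lp.coeFn_sum, Finset.sum_apply]

lemma lp_sum_single_apply (S : Finset ℕ) (f : lp E 2) (n : ℕ) :
    (∑ m ∈ S, lp.single 2 m (f m) : lp E 2) n = if n ∈ S then f n else 0 := by
  rw [lp_sum_apply]
  split_ifs with h
  · rw [Finset.sum_eq_single_of_mem n h fun m _ hm => lp.single_apply_ne _ _ _ hm.symm,
      lp.single_apply_self]
  · exact Finset.sum_eq_zero fun m hm => lp.single_apply_ne _ _ _ fun h' => h (h' ▸ hm)

/-- Bounded coordinatewise null sequences in `ℓ₂` are weakly null. -/
lemma tendsto_inner_of_tendsto_apply {w : ℕ → lp (fun _ : ℕ => ℝ) 2} {C : ℝ}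
    (hC : ∀ i, ‖w i‖ ≤ C) (hw : ∀ n, Tendsto (fun i => w i n) atTop (𝓝 0))
    (v : lp (fun _ : ℕ => ℝ) 2) : Tendsto (fun i => inner ℝ (w i) v) atTop (𝓝 0) := by
  have hC0 : 0 ≤ C := (norm_nonneg _).trans (hC 0)
  rw [Metric.tendsto_nhds]
  intro ε hε
  obtain ⟨S, hS⟩ := ((Metric.tendsto_nhds.1 (lp.hasSum_single (by simp) v))
    (ε / (2 * (C + 1))) (by positivity)).exists
  rw [dist_comm, dist_eq_norm] at hS
  set v' : lp (fun _ : ℕ => ℝ) 2 := ∑ n ∈ S, lp.single 2 n (v n) with hv'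
  have h1 : Tendsto (fun i => inner ℝ (w i) v') atTop (𝓝 0) := by
    have h := tendsto_finsetSum S fun n _ => (hw n).const_mul (v n)
    simp only [mul_zero, Finset.sum_const_zero] at h
    refine h.congr fun i => ?_
    rw [hv', inner_sum]
    exact Finset.sum_congr rfl fun n _ => by rw [lp.inner_single_right]; rfl
  filter_upwards [Metric.tendsto_nhds.1 h1 (ε / 2) (by positivity)] with i hi
  rw [dist_zero_right] at hi ⊢
  have h2 : inner ℝ (w i) v = inner ℝ (w i) v' + inner ℝ (w i) (v - v') := by
    rw [← inner_add_right, add_sub_cancel]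
  have h3 : ‖inner ℝ (w i) (v - v')‖ ≤ ε / 2 := by
    refine (norm_inner_le_norm _ _).trans ?_
    calc ‖w i‖ * ‖v - v'‖ ≤ (C + 1) * (ε / (2 * (C + 1))) := by
          gcongr
          exact (hC i).trans (by linarith)
      _ = ε / 2 := by field_simp
  rw [h2]
  exact (norm_add_le _ _).trans_lt (by linarith)

/-- If the coordinates are uniformly Cesàro null, and so are the sequences of norms of the
coordinates minus some element of `ℓ₂`, then the sequence is uniformly Cesàro null. -/
lemma uniformlyCesaroNull_lp_two {y : ℕ → lp E 2} {a : lp (fun _ : ℕ => ℝ) 2}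
    (hy : ∀ n, UniformlyCesaroNull fun i => y i n)
    (hw : UniformlyCesaroNull fun i => lp.toNorm (y i) - a) : UniformlyCesaroNull y := by
  intro ε hε
  obtain ⟨S, hS⟩ := ((Metric.tendsto_nhds.1 (lp.hasSum_single (by simp) a)) (ε / 4)
    (by positivity)).exists
  rw [dist_comm, dist_eq_norm] at hS
  choose N hN using fun n => hy n (ε / (4 * (S.card + 1))) (by positivity)
  obtain ⟨M, hM⟩ := hw (ε / 4) (by positivity)
  refine ⟨max M (S.sup N), fun F hF hc => ?_⟩
  set Z := ∑ i ∈ F, y i with hZ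
  set Z₁ : lp E 2 := ∑ n ∈ S, lp.single 2 n (Z n) with hZ₁
  have hZn : ∀ n, Z n = ∑ i ∈ F, y i n := fun n => lp_sum_apply F y n
  have h1 : ‖Z₁‖ ≤ ε / 4 * F.card := by
    refine (norm_sum_le_of_le S fun n hn => ?_ :
      ‖Z₁‖ ≤ ∑ n ∈ S, ε / (4 * (S.card + 1)) * F.card).trans ?_
    · rw [lp.norm_single (by simp), hZn]
      have hnM : N n ≤ max M (S.sup N) := (Finset.le_sup (f := N) hn).trans (le_max_right _ _)
      exact hN n F (fun i hi => hnM.trans (hF i hi)) (hnM.trans hc)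
    · rw [Finset.sum_const, nsmul_eq_mul, ← mul_assoc]
      gcongr
      rw [mul_div_assoc', div_le_div_iff₀ (by positivity) (by positivity)]
      nlinarith
  have h2 : ‖Z - Z₁‖ ≤ ε / 2 * F.card := by
    -- Off `S` the coordinates of `g` are the sums of the norms of those of the `y i`, so `g`
    -- dominates `Z - Z₁`. Its first part is small as a tail of `a`, its second by `hw`.
    set g : lp (fun _ : ℕ => ℝ) 2 := (F.card : ℝ) • (a - ∑ n ∈ S, lp.single 2 n (a n)) +
      ∑ i ∈ F, (lp.toNorm (y i) - a) with hg
    have hle : ‖Z - Z₁‖ ≤ ‖g‖ := by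
      refine lp.norm_mono two_ne_zero fun n => ?_
      rw [lp.coeFn_sub, Pi.sub_apply, hZ₁, lp_sum_single_apply]
      split_ifs with hn
      · rw [sub_self, norm_zero]
        exact norm_nonneg _
      · have hgn : g n = ∑ i ∈ F, ‖y i n‖ := by
          rw [hg, lp.coeFn_add, Pi.add_apply, lp.coeFn_smul, Pi.smul_apply, lp.coeFn_sub,
            Pi.sub_apply, lp_sum_single_apply, if_neg hn, lp_sum_apply]
          simp
        rw [sub_zero, hgn, hZn]
        exact (norm_sum_le _ _).trans (le_abs_self _)
    refine hle.trans ((norm_add_le _ _).trans ?_)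
    have h3 := hM F (fun i hi => (le_max_left _ _).trans (hF i hi)) ((le_max_left _ _).trans hc)
    have h4 : ‖(F.card : ℝ) • (a - ∑ n ∈ S, lp.single 2 n (a n))‖ ≤ ε / 4 * F.card := by
      rw [norm_smul, Real.norm_natCast, mul_comm]
      gcongr
    linarith
  calc ‖Z‖ = ‖Z₁ + (Z - Z₁)‖ := by rw [add_sub_cancel]
    _ ≤ ‖Z₁‖ + ‖Z - Z₁‖ := norm_add_le _ _
    _ ≤ ε / 4 * F.card + ε / 2 * F.card := add_le_add h1 h2
    _ ≤ ε * F.card := by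
      have : (0 : ℝ) ≤ F.card := Nat.cast_nonneg _
      nlinarith

variable [∀ n, NormedSpace ℝ (E n)]

/-- The uniform Banach-Saks property is stable under `ℓ₂` sums. -/
theorem IsUniformBanachSaks.lp_two (hE : ∀ n, IsUniformBanachSaks (E n)) :
    IsUniformBanachSaks (lp E 2) := by
  intro x C hC
  have hcoord : ∀ i n, ‖x i n‖ ≤ C := fun i n =>
    (lp.norm_apply_le_norm two_ne_zero _ _).trans (hC i)
  -- In each coordinate the Cesàro limit `l` and the limit `a` of the norms of the differences are
  -- fixed at once. Both are pointwise limits of bounded sequences in ℓ₂ sums, hence belong to such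
  -- sums. The norm sequences minus `a` are then weakly null in ℓ₂, which reduces the problem to
  -- Hilbert space.
  obtain ⟨k, hk, hP⟩ := exists_diagonal_subsequence (fun n k => ∃ l a,
      UniformlyCesaroNull (fun i => x (k i) n - l) ∧
      Tendsto (fun i => ‖x (k i) n - l‖) atTop (𝓝 a))
    (fun n k _ => by
      obtain ⟨j, hj, l, hl⟩ := hE n (fun i => x (k i) n) C fun i => hcoord _ n
      obtain ⟨a, -, j', hj', ha⟩ := tendsto_subseq_of_bounded
        (Metric.isBounded_closedBall (x := (0 : ℝ)) (r := C + ‖l‖))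
        (x := fun i => ‖x (k (j i)) n - l‖) fun i => by
          simpa using (norm_sub_le _ _).trans (by gcongr; exact hcoord _ n)
      exact ⟨j ∘ j', hj.comp hj', l, a, hl.comp_strictMono hj', ha⟩)
    (fun n k j hj ⟨l, a, hl, ha⟩ => ⟨l, a, hl.comp_strictMono hj, ha.comp hj.tendsto_atTop⟩)
    (fun n k s ⟨l, a, hl, ha⟩ => ⟨l, a, UniformlyCesaroNull.of_tail (s := s) hl,
      (tendsto_add_atTop_iff_nat s).1 ha⟩)
  choose l a hl ha using hP
  have hlmem : Memℓp l 2 := by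
    refine lp.memℓp_of_tendsto (l := atTop)
      (F := fun m : ℕ => (m : ℝ)⁻¹ • ∑ i ∈ Finset.range m, x (k i))
      ((Metric.isBounded_closedBall (x := 0) (r := C)).subset ?_) ?_
    · rintro _ ⟨m, rfl⟩
      rw [mem_closedBall_zero_iff, norm_smul, norm_inv, Real.norm_natCast]
      rcases m.eq_zero_or_pos with rfl | hm
      · simpa using (norm_nonneg _).trans (hC 0)
      · rw [inv_mul_le_iff₀ (by exact_mod_cast hm)]
        exact (norm_sum_le_of_le _ fun i _ => hC (k i)).trans_eq (by simp)
    · rw [tendsto_pi_nhds]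
      intro n
      refine (hl n).tendsto_mean.congr fun m => ?_
      rw [id, lp.coeFn_smul, Pi.smul_apply, lp_sum_apply]
  let L : lp E 2 := ⟨l, hlmem⟩
  set y : ℕ → lp E 2 := fun i => x (k i) - L with hydef
  have hyn : ∀ i n, y i n = x (k i) n - l n := fun i n => rfl
  have hyD : ∀ i, ‖lp.toNorm (y i)‖ ≤ C + ‖L‖ := fun i => by
    rw [lp.norm_toNorm]
    exact (norm_sub_le _ _).trans (by gcongr; exact hC _)
  have hamem : Memℓp a 2 := by
    refine lp.memℓp_of_tendsto (l := atTop) (F := fun i => lp.toNorm (y i))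
      ((Metric.isBounded_closedBall (x := 0) (r := C + ‖L‖)).subset ?_) ?_
    · rintro _ ⟨i, rfl⟩
      rw [mem_closedBall_zero_iff]
      exact hyD i
    · rw [tendsto_pi_nhds]
      exact fun n => ha n
  let A : lp (fun _ : ℕ => ℝ) 2 := ⟨a, hamem⟩
  obtain ⟨j, hj, hjw⟩ := exists_uniformlyCesaroNull_of_inner (w := fun i => lp.toNorm (y i) - A)
    (C := C + ‖L‖ + ‖A‖) (fun i => (norm_sub_le _ _).trans (by gcongr; exact hyD i))
    (tendsto_inner_of_tendsto_apply (C := C + ‖L‖ + ‖A‖)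
      (fun i => (norm_sub_le _ _).trans (by gcongr; exact hyD i))
      fun n => tendsto_sub_nhds_zero_iff.2 (ha n))
  exact ⟨k ∘ j, hk.comp hj, L, uniformlyCesaroNull_lp_two
    (fun n => (hl n).comp_strictMono hj) hjw⟩

end

/-! ### Tree spaces as members of `SB`, and induction on well-founded trees -/

open scoped ENNReal

/-- Extension by density of a linear map which is bounded above and below. -/
lemma exists_extension_bddBelow {V X Y : Type*} [AddCommGroup V] [Module ℝ V]
    [NormedAddCommGroup X] [NormedSpace ℝ X] [NormedAddCommGroup Y] [NormedSpace ℝ Y]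
    [CompleteSpace Y] (e : V →ₗ[ℝ] X) (f : V →ₗ[ℝ] Y) (he : DenseRange e) {c C : ℝ}
    (h1 : ∀ v, c * ‖e v‖ ≤ ‖f v‖) (h2 : ∀ v, ‖f v‖ ≤ C * ‖e v‖) :
    ∃ J : X →L[ℝ] Y, ∀ x, c * ‖x‖ ≤ ‖J x‖ := by
  refine ⟨f.extendOfNorm e, fun x => ?_⟩
  refine he.induction_on x (isClosed_le (by fun_prop) (by fun_prop)) fun v => ?_
  rw [LinearMap.extendOfNorm_eq he ⟨C, h2⟩]
  exact h1 v

instance (X : SB) : CompleteSpace X.Carrier := X.isClosed.completeSpace_coe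

section TreeSpace

variable (q : ℝ) (hq : 1 ≤ q) (m : ℕ) (T : List ℕ → Bool)

/-- A realisation of the unit vectors of the tree space in `C(2^ℕ)`. -/
noncomputable def treeCode : List ℕ → CantorC :=
  (exists_cantorC_coding (treeSeminorm q hq m)).choose

lemma norm_linearCombination_treeCode (z : List ℕ →₀ ℝ) :
    ‖Finsupp.linearCombination ℝ (treeCode q hq m) z‖ = treeNorm q m z :=
  (exists_cantorC_coding (treeSeminorm q hq m)).choose_spec z

/-- The closed subspace of the tree space spanned by the unit vectors at the nodes in `T`. -/
noncomputable def treeSpace : SB where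
  toSubmodule := (Submodule.span ℝ (treeCode q hq m '' {s | T s = true})).topologicalClosure
  isClosed' := Submodule.isClosed_topologicalClosure _

lemma treeCode_mem_treeSpace {s : List ℕ} (hs : T s = true) :
    treeCode q hq m s ∈ (treeSpace q hq m T).toSubmodule :=
  Submodule.le_topologicalClosure _ (Submodule.subset_span ⟨s, hs, rfl⟩)

/-- The tree space of `T` as a type. -/
def TreeSpace : Type := (treeSpace q hq m T).Carrier

noncomputable instance : NormedAddCommGroup (TreeSpace q hq m T) :=
  inferInstanceAs (NormedAddCommGroup (treeSpace q hq m T).Carrier)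

noncomputable instance : NormedSpace ℝ (TreeSpace q hq m T) :=
  inferInstanceAs (NormedSpace ℝ (treeSpace q hq m T).Carrier)

instance : CompleteSpace (TreeSpace q hq m T) :=
  inferInstanceAs (CompleteSpace (treeSpace q hq m T).Carrier)

/-- The finitely supported elements of the tree space of `T`. -/
noncomputable def treeMap :
    Finsupp.supported ℝ ℝ {s | T s = true} →ₗ[ℝ] TreeSpace q hq m T :=
  (Finsupp.linearCombination ℝ (treeCode q hq m) ∘ₗ Submodule.subtype _).codRestrict
    (treeSpace q hq m T).toSubmodule fun z => by
    refine Submodule.le_topologicalClosure _ ?_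
    rw [Finsupp.span_image_eq_map_linearCombination]
    exact ⟨z, z.2, rfl⟩

lemma norm_treeMap (z : Finsupp.supported ℝ ℝ {s | T s = true}) :
    ‖treeMap q hq m T z‖ = treeNorm q m z :=
  norm_linearCombination_treeCode q hq m z

lemma denseRange_treeMap : DenseRange (treeMap q hq m T) := by
  intro x
  obtain ⟨x, hx⟩ := x
  refine Metric.mem_closure_iff.2 fun ε hε => ?_
  have hx' : x ∈ closure (Submodule.span ℝ (treeCode q hq m '' {s | T s = true}) : Set CantorC) := hx
  obtain ⟨y, hy, hxy⟩ := Metric.mem_closure_iff.1 hx' ε hε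
  rw [SetLike.mem_coe, Finsupp.span_image_eq_map_linearCombination] at hy
  obtain ⟨z, hz, rfl⟩ := hy
  exact ⟨_, ⟨⟨z, hz⟩, rfl⟩, hxy⟩

lemma treeSpace_empty_eq_zero (x : TreeSpace q hq m fun _ => false) : x = 0 := by
  obtain ⟨x, hx⟩ := x
  have hx' : x ∈ closure (Submodule.span ℝ
    (treeCode q hq m '' {s : List ℕ | (fun _ => false) s = true}) : Set CantorC) := hx
  simp only [Bool.false_eq_true, Set.ofPred_false, Set.image_empty, Submodule.span_empty,
    Submodule.bot_coe, closure_singleton, Set.mem_singleton_iff] at hx'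
  exact Subtype.ext hx'

/-- The restriction of finitely supported functions on `T` to an immediate subtree. -/
noncomputable def supportedChildMap (n : ℕ) : Finsupp.supported ℝ ℝ {s | T s = true} →ₗ[ℝ]
    Finsupp.supported ℝ ℝ {s | subtree T n s = true} :=
  (childMap n).restrict fun z hz => by
    rw [Finsupp.mem_supported] at hz ⊢
    intro s hs
    rw [SetLike.mem_coe, Finsupp.mem_support_iff, childMap_apply] at hs
    exact hz (Finsupp.mem_support_iff.2 hs)

end TreeSpace

section Sum

variable {W : Type*} [AddCommGroup W] [Module ℝ W] {E : ℕ → Type*} [∀ n, NormedAddCommGroup (E n)]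
  [∀ n, NormedSpace ℝ (E n)] (p : ℝ≥0∞) [Fact (1 ≤ p)]

/-- A linear map into an `ℓ_p` sum with given coordinates. -/
def linearMapIntoLp (t : ∀ n, W →ₗ[ℝ] E n) (h : ∀ w, Memℓp (fun n => t n w) p) :
    W →ₗ[ℝ] lp E p where
  toFun w := ⟨fun n => t n w, h w⟩
  map_add' w v := lp.ext (funext fun n => map_add (t n) w v)
  map_smul' a w := lp.ext (funext fun n => map_smul (t n) a w)

/-- Up to equivalence, the tree space is the sum of a line and of the `ℓ_p` sum of the tree spaces
of the immediate subtrees. -/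
lemma exists_embedding_real_prod_lp {X : Type*} [NormedAddCommGroup X] [NormedSpace ℝ X]
    [∀ n, CompleteSpace (E n)] (hp : 1 ≤ p.toReal) (m : ℕ) (ι : W →ₗ[ℝ] (List ℕ →₀ ℝ))
    (e : W →ₗ[ℝ] X) (he : DenseRange e) (hN : ∀ w, ‖e w‖ = treeNorm p.toReal m (ι w))
    (t : ∀ n, W →ₗ[ℝ] E n)
    (ht : ∀ n w, ‖t n w‖ = treeNorm p.toReal (m + 1) (childMap n (ι w))) :
    ∃ J : X →L[ℝ] ℝ × lp E p, ∀ x, 2⁻¹ * ‖x‖ ≤ ‖J x‖ := by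
  have hmem : ∀ w, Memℓp (fun n => t n w) p := fun w => by
    refine memℓp_gen ?_
    simp only [ht]
    exact summable_treeNorm hp (m + 1) (ι w)
  have hnorm : ∀ w, ‖linearMapIntoLp p t hmem w‖ =
      ellNorm p.toReal fun n => treeNorm p.toReal (m + 1) (childMap n (ι w)) := fun w => by
    rw [lp.norm_eq_tsum_rpow (by linarith)]
    refine congrArg (· ^ (1 / p.toReal)) (tsum_congr fun n => ?_)
    exact congrArg (· ^ p.toReal) (ht n w)
  refine exists_extension_bddBelow e ((Finsupp.lapply [] ∘ₗ ι).prod (linearMapIntoLp p t hmem)) he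
    (C := 1) (fun w => ?_) fun w => ?_
  -- The constant 1/2 compares a sum of two terms with the maximum norm of the product.
  · have h1 := treeNorm_le_abs_add hp m (ι w)
    rw [← hnorm, ← hN] at h1
    have h2 : |ι w []| ≤ ‖(Finsupp.lapply [] ∘ₗ ι).prod (linearMapIntoLp p t hmem) w‖ :=
      norm_fst_le ((Finsupp.lapply [] ∘ₗ ι).prod (linearMapIntoLp p t hmem) w)
    have h3 : ‖linearMapIntoLp p t hmem w‖ ≤
        ‖(Finsupp.lapply [] ∘ₗ ι).prod (linearMapIntoLp p t hmem) w‖ :=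
      norm_snd_le ((Finsupp.lapply [] ∘ₗ ι).prod (linearMapIntoLp p t hmem) w)
    linarith
  · rw [one_mul, hN]
    refine max_le ?_ ((hnorm w).trans_le (ellNorm_childMap_le_treeNorm hp m (ι w)))
    exact ((abs_apply_nil_le_pathNorm m (ι w)).trans (pathNorm_le_treeNorm hp m (ι w)))

end Sum

lemma one_le_toReal_one : 1 ≤ (1 : ℝ≥0∞).toReal := by simp

lemma one_le_toReal_two : 1 ≤ (2 : ℝ≥0∞).toReal := by simp

section Step

variable {W : Type*} [AddCommGroup W] [Module ℝ W] {E : ℕ → Type*} [∀ n, NormedAddCommGroup (E n)]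
  [∀ n, NormedSpace ℝ (E n)] {X : Type*} [NormedAddCommGroup X] [NormedSpace ℝ X]
  [∀ n, CompleteSpace (E n)] {m : ℕ} {ι : W →ₗ[ℝ] (List ℕ →₀ ℝ)} {e : W →ₗ[ℝ] X}
  {t : ∀ n, W →ₗ[ℝ] E n}

lemma IsSchur.of_children (hE : ∀ n, IsSchur (E n)) (he : DenseRange e)
    (hN : ∀ w, ‖e w‖ = treeNorm (1 : ℝ≥0∞).toReal m (ι w))
    (ht : ∀ n w, ‖t n w‖ = treeNorm (1 : ℝ≥0∞).toReal (m + 1) (childMap n (ι w))) :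
    IsSchur X := by
  obtain ⟨J, hJ⟩ := exists_embedding_real_prod_lp 1 one_le_toReal_one m ι e he hN t ht
  exact (IsSchur.lp_one hE).real_prod.of_bddBelow J (by norm_num) hJ

lemma IsUniformBanachSaks.of_children [CompleteSpace X] (hE : ∀ n, IsUniformBanachSaks (E n))
    (he : DenseRange e) (hN : ∀ w, ‖e w‖ = treeNorm (2 : ℝ≥0∞).toReal m (ι w))
    (ht : ∀ n w, ‖t n w‖ = treeNorm (2 : ℝ≥0∞).toReal (m + 1) (childMap n (ι w))) :
    IsUniformBanachSaks X := by
  obtain ⟨J, hJ⟩ := exists_embedding_real_prod_lp 2 one_le_toReal_two m ι e he hN t ht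
  exact (isUniformBanachSaks_real.prod (IsUniformBanachSaks.lp_two hE)).of_bddBelow J
    (by norm_num) hJ

end Step

/-- The restriction of finitely supported functions on `T` to an immediate subtree, as a map into
the tree space of the subtree. -/
noncomputable def treeChildMap (q : ℝ) (hq : 1 ≤ q) (m : ℕ) (T : List ℕ → Bool) (n : ℕ) :
    Finsupp.supported ℝ ℝ {s | T s = true} →ₗ[ℝ]
    TreeSpace q hq (m + 1) (subtree T n) :=
  treeMap q hq (m + 1) (subtree T n) ∘ₗ supportedChildMap T n

lemma norm_treeChildMap (q : ℝ) (hq : 1 ≤ q) (m : ℕ) (T : List ℕ → Bool) (n : ℕ)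
    (w : Finsupp.supported ℝ ℝ {s | T s = true}) :
    ‖treeChildMap q hq m T n w‖ = treeNorm q (m + 1) (childMap n (Submodule.subtype _ w)) :=
  norm_treeMap q hq (m + 1) (subtree T n) (supportedChildMap T n w)

theorem isSchur_treeSpace {T : List ℕ → Bool} (hT : IsPrefixClosed T)
    (hb : ∀ β, ¬ IsBranch T β) (m : ℕ) :
    IsSchur (TreeSpace _ one_le_toReal_one m T) := by
  -- The root index `m` is quantified inside the property because it rises by one on passing to a
  -- subtree.
  refine wellFoundedTree_induction
    (P := fun T => ∀ m, IsSchur (TreeSpace _ one_le_toReal_one m T))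
    (fun m x _ => ?_) (fun T h m => ?_) hT hb m
  · rw [show x = fun _ => 0 from funext fun n => treeSpace_empty_eq_zero _ _ _ (x n)]
    exact tendsto_const_nhds
  · have h' : ∀ n, IsSchur (TreeSpace _ one_le_toReal_one (m + 1) (subtree T n)) :=
      fun n => h n (m + 1)
    exact IsSchur.of_children
      (E := fun n => (TreeSpace _ one_le_toReal_one (m + 1) (subtree T n)))
      (X := TreeSpace _ one_le_toReal_one m T)
      (W := Finsupp.supported ℝ ℝ {s : List ℕ | T s = true}) (ι := Submodule.subtype _)
      (e := treeMap _ one_le_toReal_one m T) (t := treeChildMap _ one_le_toReal_one m T) h'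
      (denseRange_treeMap _ one_le_toReal_one m T)
      (norm_treeMap _ one_le_toReal_one m T) (norm_treeChildMap _ one_le_toReal_one m T)

theorem isUniformBanachSaks_treeSpace {T : List ℕ → Bool} (hT : IsPrefixClosed T)
    (hb : ∀ β, ¬ IsBranch T β) (m : ℕ) :
    IsUniformBanachSaks (TreeSpace _ one_le_toReal_two m T) := by
  refine wellFoundedTree_induction
    (P := fun T => ∀ m, IsUniformBanachSaks (TreeSpace _ one_le_toReal_two m T))
    (fun m x C _ => ?_) (fun T h m => ?_) hT hb m
  · refine ⟨id, strictMono_id, 0, UniformlyCesaroNull.of_tendsto ?_⟩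
    simp only [treeSpace_empty_eq_zero _ _ _ (x _), sub_zero]
    exact tendsto_const_nhds
  · have h' : ∀ n, IsUniformBanachSaks
        (TreeSpace _ one_le_toReal_two (m + 1) (subtree T n)) := fun n => h n (m + 1)
    exact IsUniformBanachSaks.of_children
      (E := fun n => (TreeSpace _ one_le_toReal_two (m + 1) (subtree T n)))
      (X := TreeSpace _ one_le_toReal_two m T)
      (W := Finsupp.supported ℝ ℝ {s : List ℕ | T s = true}) (ι := Submodule.subtype _)
      (e := treeMap _ one_le_toReal_two m T) (t := treeChildMap _ one_le_toReal_two m T) h'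
      (denseRange_treeMap _ one_le_toReal_two m T)
      (norm_treeMap _ one_le_toReal_two m T) (norm_treeChildMap _ one_le_toReal_two m T)

/-! ### Borel complexity and Bossard genericity -/

/-- The membership relation between points of `C(2^ℕ)` and closed subspaces is Borel. -/
lemma measurableSet_mem_SB [MeasurableSpace CantorC] [BorelSpace CantorC] :
    MeasurableSet {p : SB × CantorC | p.2 ∈ p.1} := by
  have h : {p : SB × CantorC | p.2 ∈ p.1} =
      ⋂ U ∈ TopologicalSpace.countableBasis CantorC,
        {p : SB × CantorC | p.2 ∈ U}ᶜ ∪ {p | ((p.1 : Set CantorC) ∩ U).Nonempty} := by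
    ext p
    simp only [Set.mem_ofPred_eq, Set.mem_iInter, Set.mem_union, Set.mem_compl_iff]
    have hcl : p.2 ∈ p.1 ↔ p.2 ∈ closure (p.1 : Set CantorC) := by
      rw [p.1.isClosed.closure_eq]; rfl
    rw [hcl, (TopologicalSpace.isBasis_countableBasis CantorC).mem_closure_iff]
    refine forall₂_congr fun U _ => ?_
    rw [Set.inter_comm, imp_iff_not_or]
  rw [h]
  refine MeasurableSet.biInter (TopologicalSpace.countable_countableBasis CantorC) fun U hU => ?_
  have hUo := TopologicalSpace.isOpen_of_mem_countableBasis hU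
  have hU' : MeasurableSet {X : SB | ((X : Set CantorC) ∩ U).Nonempty} :=
    MeasurableSpace.measurableSet_generateFrom ⟨U, hUo, rfl⟩
  exact (measurable_snd hUo.measurableSet).compl.union (measurable_fst hU')

/-- Pairs of a tree and a sequence in `C(2^ℕ)`, which, along the tree, is `K`-equivalent to the unit
vectors of the tree space. -/
def treeEquivalentPairs (q : ℝ) (K : ℕ) : Set ((List ℕ → Bool) × (List ℕ → CantorC)) :=
  {p | ∀ z : List ℕ →₀ ℝ, (∀ s ∈ z.support, p.1 s = true) →
    treeNorm q 0 z ≤ K * ‖Finsupp.linearCombination ℝ p.2 z‖ ∧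
      ‖Finsupp.linearCombination ℝ p.2 z‖ ≤ K * treeNorm q 0 z}

/-- For each `z` the premise tests finitely many nodes, so it is an open condition on the tree, and
the two estimates are closed. -/
lemma isClosed_treeEquivalentPairs (q : ℝ) (K : ℕ) : IsClosed (treeEquivalentPairs q K) := by
  rw [treeEquivalentPairs, Set.ofPred_forall]
  refine isClosed_iInter fun z => ?_
  have hcont : Continuous fun p : (List ℕ → Bool) × (List ℕ → CantorC) =>
      Finsupp.linearCombination ℝ p.2 z := by
    simp only [Finsupp.linearCombination_apply, Finsupp.sum]
    fun_prop
  refine isClosed_imp ?_ ?_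
  · simp only [Set.ofPred_forall]
    exact isOpen_biInter_finset fun s _ => (isOpen_discrete ({true} : Set Bool)).preimage
      (f := fun p : (List ℕ → Bool) × (List ℕ → CantorC) => p.1 s)
      ((continuous_apply s).comp continuous_fst)
  · exact (isClosed_le continuous_const (continuous_const.mul hcont.norm)).inter
      (isClosed_le hcont.norm continuous_const)

lemma exists_equiv_submodule_of_bddBelow {X Y : Type*} [NormedAddCommGroup X] [NormedSpace ℝ X]
    [NormedAddCommGroup Y] [NormedSpace ℝ Y] [CompleteSpace X] [CompleteSpace Y] (J : X →L[ℝ] Y)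
    {c : ℝ} (hc : 0 < c) (hJ : ∀ x, c * ‖x‖ ≤ ‖J x‖) :
    ∃ Z : Submodule ℝ Y, Nonempty (X ≃L[ℝ] Z) := by
  have hanti : AntilipschitzWith (Real.toNNReal c⁻¹) J := J.antilipschitz_of_bound fun z => by
    rw [Real.coe_toNNReal _ (by positivity), ← div_eq_inv_mul, le_div_iff₀' hc]
    exact hJ z
  exact ⟨LinearMap.range (J : X →ₗ[ℝ] Y),
    ⟨J.equivRange hanti.injective (hanti.isClosed_range J.uniformContinuous)⟩⟩

lemma ContinuousLinearEquiv.exists_nat_bound {X Y : Type*} [NormedAddCommGroup X] [NormedSpace ℝ X]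
    [NormedAddCommGroup Y] [NormedSpace ℝ Y] (φ : X ≃L[ℝ] Y) :
    ∃ K : ℕ, ∀ x, ‖x‖ ≤ K * ‖φ x‖ ∧ ‖φ x‖ ≤ K * ‖x‖ := by
  obtain ⟨K, hK⟩ := exists_nat_ge (max ‖(φ : X →L[ℝ] Y)‖ ‖(φ.symm : Y →L[ℝ] X)‖)
  refine ⟨K, fun x => ⟨?_, (φ : X →L[ℝ] Y).le_of_opNorm_le ((le_max_left _ _).trans hK) x⟩⟩
  simpa using (φ.symm : Y →L[ℝ] X).le_of_opNorm_le ((le_max_right _ _).trans hK) (φ x)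

/-- A sequence which, along a branch, is equivalent to the unit vectors of the tree space spans a
copy of `C(2^ℕ)`. -/
lemma exists_bddBelow_of_branch {Y : Type*} [NormedAddCommGroup Y] [NormedSpace ℝ Y]
    [CompleteSpace Y] {q : ℝ} (hq : 1 ≤ q) {K : ℕ} {y : List ℕ → Y} {β : ℕ → ℕ}
    (hy : ∀ c, treeNorm q 0 (alongBranch β c) ≤
        K * ‖Finsupp.linearCombination ℝ y (alongBranch β c)‖ ∧
      ‖Finsupp.linearCombination ℝ y (alongBranch β c)‖ ≤ K * treeNorm q 0 (alongBranch β c)) :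
    ∃ J : CantorC →L[ℝ] Y, ∀ x, ((K : ℝ) + 1)⁻¹ * ‖x‖ ≤ ‖J x‖ := by
  have hdense : DenseRange (Finsupp.linearCombination ℝ cantorBasis) := by
    rw [DenseRange, ← LinearMap.coe_range, Finsupp.range_linearCombination]
    exact Submodule.dense_iff_topologicalClosure_eq_top.2 topologicalClosure_span_cantorBasis
  -- `K + 1` keeps the constant positive when `K = 0`.
  have h₁ : ∀ c, ((K : ℝ) + 1)⁻¹ * ‖Finsupp.linearCombination ℝ cantorBasis c‖ ≤
      ‖(Finsupp.linearCombination ℝ y ∘ₗ alongBranch β) c‖ := fun c => by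
    rw [inv_mul_le_iff₀ (by positivity)]
    refine ((norm_le_treeNorm_alongBranch hq β c).trans (hy c).1).trans ?_
    exact mul_le_mul_of_nonneg_right (by linarith) (norm_nonneg _)
  have h₂ : ∀ c, ‖(Finsupp.linearCombination ℝ y ∘ₗ alongBranch β) c‖ ≤
      (K * 2 : ℝ) * ‖Finsupp.linearCombination ℝ cantorBasis c‖ := fun c => by
    rw [mul_assoc]
    exact (hy c).2.trans
      (mul_le_mul_of_nonneg_left (treeNorm_alongBranch_le hq β c) K.cast_nonneg)
  obtain ⟨J, hJ⟩ := exists_extension_bddBelow (Finsupp.linearCombination ℝ cantorBasis)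
    (Finsupp.linearCombination ℝ y ∘ₗ alongBranch β) hdense h₁ h₂
  exact ⟨J, hJ⟩

/-- A closed subspace containing a sequence which, along a branch, is equivalent to the unit vectors
of the tree space contains copies of all closed subspaces of `C(2^ℕ)`. -/
lemma exists_equiv_submodule_of_branch {U : Type*} [NormedAddCommGroup U] [NormedSpace ℝ U]
    (P : Submodule ℝ U) [CompleteSpace P] (Z : Submodule ℝ CantorC) [CompleteSpace Z] {q : ℝ}
    (hq : 1 ≤ q) {K : ℕ} {y : List ℕ → U} (hP : ∀ s, y s ∈ P) {β : ℕ → ℕ}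
    (hy : ∀ c, treeNorm q 0 (alongBranch β c) ≤
        K * ‖Finsupp.linearCombination ℝ y (alongBranch β c)‖ ∧
      ‖Finsupp.linearCombination ℝ y (alongBranch β c)‖ ≤ K * treeNorm q 0 (alongBranch β c)) :
    ∃ W : Submodule ℝ P, Nonempty (Z ≃L[ℝ] W) := by
  have hy' : ∀ z, ‖Finsupp.linearCombination ℝ (fun s => (⟨y s, hP s⟩ : P)) z‖ =
      ‖Finsupp.linearCombination ℝ y z‖ :=
    fun z => congrArg norm (Finsupp.apply_linearCombination ℝ P.subtype _ z)
  obtain ⟨J, hJ⟩ := exists_bddBelow_of_branch hq (y := fun s => (⟨y s, hP s⟩ : P)) (K := K)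
    (β := β) fun c => by rw [hy']; exact hy c
  exact exists_equiv_submodule_of_bddBelow (X := Z) (J.comp (Submodule.subtypeL Z))
    (c := ((K : ℝ) + 1)⁻¹) (by positivity) fun z => hJ z

/-- A space containing a sequence equivalent to the unit vectors along a branch of a tree contains
copies of all separable spaces. -/
lemma containsCopy_of_branch {q : ℝ} (hq : 1 ≤ q) {K : ℕ} {T : List ℕ → Bool}
    {y : List ℕ → CantorC} {X : SB} (hy : ∀ s, y s ∈ X) (h : (T, y) ∈ treeEquivalentPairs q K)
    {β : ℕ → ℕ} (hβ : IsBranch T β) (Z : SB) : SB.ContainsCopy X Z :=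
  exists_equiv_submodule_of_branch X.toSubmodule Z.toSubmodule hq hy fun c =>
    h _ fun s hs => by
      obtain ⟨k, rfl⟩ := exists_of_alongBranch_ne_zero (Finsupp.mem_support_iff.1 hs)
      exact hβ k

/-- Vectors with index outside `p` are replaced by 0, so that the image family lies in `Q` at every
index. -/
lemma exists_image_equivalent {U ι : Type*} [NormedAddCommGroup U] [NormedSpace ℝ U]
    {P Q : Submodule ℝ U} (φ : P ≃L[ℝ] Q) {p : Set ι} {u : ι → U} (hu : ∀ i ∈ p, u i ∈ P) :
    ∃ y : ι → U, (∀ i, y i ∈ Q) ∧ ∃ K : ℕ, ∀ z : ι →₀ ℝ, (∀ i ∈ z.support, i ∈ p) →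
      ‖Finsupp.linearCombination ℝ u z‖ ≤ K * ‖Finsupp.linearCombination ℝ y z‖ ∧
        ‖Finsupp.linearCombination ℝ y z‖ ≤ K * ‖Finsupp.linearCombination ℝ u z‖ := by
  classical
  let v : ι → P := fun i => if h : i ∈ p then ⟨u i, hu i h⟩ else 0
  obtain ⟨K, hK⟩ := φ.exists_nat_bound
  refine ⟨fun i => φ (v i), fun i => (φ (v i)).2, K, fun z hz => ?_⟩
  have hv : ‖Finsupp.linearCombination ℝ u z‖ = ‖Finsupp.linearCombination ℝ v z‖ := by
    rw [Submodule.coe_norm, ← Submodule.coe_subtype, Finsupp.apply_linearCombination,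
      Finsupp.linearCombination_apply, Finsupp.linearCombination_apply]
    congr 1
    refine Finset.sum_congr rfl fun i hi => ?_
    simp [v, hz i hi]
  have hφ : ‖Finsupp.linearCombination ℝ (fun i => (φ (v i) : U)) z‖ =
      ‖φ (Finsupp.linearCombination ℝ v z)‖ := by
    have h : φ (Finsupp.linearCombination ℝ v z) =
        Finsupp.linearCombination ℝ (fun i => φ (v i)) z :=
      Finsupp.apply_linearCombination ℝ (φ : P →ₗ[ℝ] Q) v z
    rw [h, Submodule.coe_norm, ← Submodule.coe_subtype, Finsupp.apply_linearCombination]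
    rfl
  rw [hφ, hv]
  exact hK _

lemma exists_treeEquivalentPairs {q : ℝ} (hq : 1 ≤ q) {T : List ℕ → Bool} {X : SB}
    (φ : (treeSpace q hq 0 T).Carrier ≃L[ℝ] X.Carrier) :
    ∃ y : List ℕ → CantorC, (∀ s, y s ∈ X) ∧ ∃ K, (T, y) ∈ treeEquivalentPairs q K := by
  obtain ⟨y, hy, K, hK⟩ := exists_image_equivalent (U := CantorC)
    (P := (treeSpace q hq 0 T).toSubmodule) (Q := X.toSubmodule) φ (p := {s | T s = true})
    (u := treeCode q hq 0) fun s hs => treeCode_mem_treeSpace q hq 0 T hs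
  refine ⟨y, hy, K, fun z hz => ?_⟩
  rw [← norm_linearCombination_treeCode q hq]
  exact hK z hz

/-- A class of spaces containing all tree spaces over well-founded trees is Bossard generic. -/
theorem bossardGeneric_of_treeSpace_mem {C : Set SB} {q : ℝ} (hq : 1 ≤ q)
    (hC : ∀ T, IsPrefixClosed T → (∀ β, ¬ IsBranch T β) → treeSpace q hq 0 T ∈ C) :
    SB.BossardGeneric C := by
  rintro _ ⟨S', _, _, B, f, hB, hf, rfl⟩ hA
  let _ : MeasurableSpace CantorC := borel CantorC
  have : BorelSpace CantorC := ⟨rfl⟩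
  -- The projection of this Borel set to the first factor is the analytic set of trees whose unit
  -- vectors are represented in some member of the given class.
  let G : Set ((List ℕ → Bool) × S' × (List ℕ → CantorC)) :=
    {t | t.2.1 ∈ B ∧ (∀ s, t.2.2 s ∈ f t.2.1) ∧ ∃ K, (t.1, t.2.2) ∈ treeEquivalentPairs q K}
  have hG : MeasurableSet G := by
    refine (measurable_snd.fst hB).inter (MeasurableSet.inter ?_ ?_)
    · change MeasurableSet {t : (List ℕ → Bool) × S' × (List ℕ → CantorC) |
        ∀ s, t.2.2 s ∈ f t.2.1}
      rw [Set.ofPred_forall]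
      refine MeasurableSet.iInter fun s => ?_
      have hm : Measurable fun t : (List ℕ → Bool) × S' × (List ℕ → CantorC) =>
          (f t.2.1, t.2.2 s) :=
        (hf.comp measurable_snd.fst).prodMk ((measurable_pi_apply s).comp measurable_snd.snd)
      exact hm measurableSet_mem_SB
    · change MeasurableSet {t : (List ℕ → Bool) × S' × (List ℕ → CantorC) |
        ∃ K, (t.1, t.2.2) ∈ treeEquivalentPairs q K}
      rw [Set.ofPred_exists]
      refine MeasurableSet.iUnion fun K => ?_
      exact (measurable_fst.prodMk measurable_snd.snd)
        (isClosed_treeEquivalentPairs q K).measurableSet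
  have : PolishSpace CantorC := inferInstance
  have : StandardBorelSpace CantorC := inferInstance
  have : StandardBorelSpace (List ℕ → Bool) := inferInstance
  have : StandardBorelSpace (List ℕ → CantorC) := inferInstance
  obtain ⟨T, ⟨⟨T', b, y⟩, ⟨hb, hy, K, hK⟩, rfl⟩, β, hβ⟩ := exists_branch_of_analyticSet
    (hG.analyticSet_image measurable_fst) fun T hT hTb => by
      obtain ⟨_, ⟨b, hb, rfl⟩, ⟨φ⟩⟩ := hA _ (hC T hT hTb)
      obtain ⟨y, hy, hK⟩ := exists_treeEquivalentPairs hq φ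
      exact ⟨(T, b, y), ⟨hb, hy, hK⟩, rfl⟩
  exact ⟨f b, ⟨b, hb, rfl⟩, containsCopy_of_branch hq hy hK hβ⟩

lemma exists_bddBelow_of_not_isSingularOp {E X : Type*} [NormedAddCommGroup E] [NormedSpace ℝ E]
    [NormedAddCommGroup X] [NormedSpace ℝ X]
    (h : ¬ IsSingularOp E (ContinuousLinearMap.id ℝ X)) :
    ∃ (J : E →L[ℝ] X) (c : ℝ), 0 < c ∧ ∀ x, c * ‖x‖ ≤ ‖J x‖ := by
  obtain ⟨Z, ⟨φ⟩, -⟩ := not_not.1 h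
  refine ⟨(Submodule.subtypeL Z).comp (φ : E →L[ℝ] Z), (‖(φ.symm : Z →L[ℝ] E)‖ + 1)⁻¹,
    by positivity, fun x => ?_⟩
  rw [inv_mul_le_iff₀ (by positivity)]
  have := (φ.symm : Z →L[ℝ] E).le_of_opNorm_le (le_add_of_nonneg_right zero_le_one) (φ x)
  simpa using this

/-- Both properties pass to isomorphic subspaces, and an infinite-dimensional E cannot have both;
the exponent is chosen to give a property that E lacks. -/
theorem bossardGeneric_NC (E : Type*) [NormedAddCommGroup E] [NormedSpace ℝ E] [CompleteSpace E]
    (hE : ¬ FiniteDimensional ℝ E) : SB.BossardGeneric (SB.NC E) := by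
  by_cases h : IsSchur E
  · refine bossardGeneric_of_treeSpace_mem one_le_toReal_two fun T hT hb => ?_
    by_contra hnot
    obtain ⟨J, c, hc, hJ⟩ := exists_bddBelow_of_not_isSingularOp hnot
    have hBS : IsUniformBanachSaks (treeSpace _ one_le_toReal_two 0 T).Carrier :=
      isUniformBanachSaks_treeSpace hT hb 0
    exact hE (h.finiteDimensional (hBS.of_bddBelow J hc hJ))
  · refine bossardGeneric_of_treeSpace_mem one_le_toReal_one fun T hT hb => ?_
    by_contra hnot
    obtain ⟨J, c, hc, hJ⟩ := exists_bddBelow_of_not_isSingularOp hnot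
    have hS : IsSchur (treeSpace _ one_le_toReal_one 0 T).Carrier := isSchur_treeSpace hT hb 0
    exact h (hS.of_bddBelow J hc hJ)

theorem mainTheorem8 :
    SB.BossardGeneric SB.DP ∧
    SB.BossardGeneric SB.V ∧
    SB.BossardGeneric SB.BS ∧
    (∀ (E : Type*) [NormedAddCommGroup E] [NormedSpace ℝ E] [CompleteSpace E]
      [TopologicalSpace.SeparableSpace E], ¬ FiniteDimensional ℝ E →
        SB.BossardGeneric (SB.NC E)) ∧
    SB.BossardGeneric SB.WBS := by
  have hS : ∀ T, IsPrefixClosed T → (∀ β, ¬ IsBranch T β) →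
      IsSchur (treeSpace _ one_le_toReal_one 0 T).Carrier :=
    fun T hT hb => isSchur_treeSpace hT hb 0
  have hQ : ∀ T, IsPrefixClosed T → (∀ β, ¬ IsBranch T β) →
      IsUniformBanachSaks (treeSpace _ one_le_toReal_two 0 T).Carrier :=
    fun T hT hb => isUniformBanachSaks_treeSpace hT hb 0
  refine ⟨?_, ?_, ?_, fun E _ _ _ _ hE => bossardGeneric_NC E hE, ?_⟩
  · exact bossardGeneric_of_treeSpace_mem one_le_toReal_one fun T hT hb =>
      (hS T hT hb).isDunfordPettisOp
  · exact bossardGeneric_of_treeSpace_mem one_le_toReal_one fun T hT hb =>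
      (hS T hT hb).isCompletelyContinuousOp
  · exact bossardGeneric_of_treeSpace_mem one_le_toReal_two fun T hT hb =>
      (hQ T hT hb).isBanachSaksOp
  · exact bossardGeneric_of_treeSpace_mem one_le_toReal_one fun T hT hb =>
      (hS T hT hb).isWeakBanachSaksOp
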